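/- Let $\mathbb F$ be a field of characteristic zero and $\mathbb N=\{0,1,2,\dots\}$. Let $O$ be the Onsager Lie algebra over $\mathbb F$: the Lie algebra with generators $A,B$ and relations $[A,[A,[A,B]]]=4[A,B]$, $[B,[B,[B,A]]]=4[B,A]$. Let $\boxtimes$ be the tetrahedron algebra over $\mathbb F$: the Lie algebra with generators $x_{ij}$ ($i,j\in\{0,1,2,3\}$, $i\neq j$) and relations $x_{ij}+x_{ji}=0$ for distinct $i,j$; $[x_{ij},x_{jk}]=2x_{ij}+2x_{jk}$ for mutually distinct $i,j,k$; $[x_{ij},[x_{ij},[x_{ij},x_{kh}]]]=4[x_{ij},x_{kh}]$ for mutually distinct $h,i,j,k$. An element $\xi\in\boxtimes$ is called $x_{ij}$-like when $[x_{ij},\xi]=0$ and $[x_{kh},[x_{kh},[x_{kh},\xi]]]=4[x_{kh},\xi]$ whenever $h,i,j,k$ are mutually distinct. Let $e,f,h$ be the standard basis of $\mathfrak{sl}_2$ ($[h,e]=2e$, $[h,f]=-2f$, $[e,f]=h$), and put $x=2e-h$, $y=-2f-h$, $z=h$. Let $t$ be an indeterminate, $\mathcal A=\mathbb F[t,t^{-1},(t-1)^{-1}]$,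 $t'=1-t^{-1}$, $t''=(1-t)^{-1}$, and let $L(\mathfrak{sl}_2)^+=\mathfrak{sl}_2\otimes\mathcal A$ with the Lie bracket $[u\otimes a,v\otimes b]=[u,v]\otimes ab$; it is a right $\mathcal A$-module by $(u\otimes a)b=u\otimes ab$. Let $\sigma:\boxtimes\to L(\mathfrak{sl}_2)^+$ be the Lie algebra homomorphism with $$x_{12}\mapsto x\otimes1,\quad x_{23}\mapsto y\otimes1,\quad x_{31}\mapsto z\otimes1,\quad x_{03}\mapsto y\otimes t+z\otimes(t-1),$$ $$x_{01}\mapsto z\otimes t'+x\otimes(t'-1),\quad x_{02}\mapsto x\otimes t''+y\otimes(t''-1),$$ and let $\iota:O\to\boxtimes$ be the Lie algebra homomorphism with $A\mapsto x_{12}$, $B\mapsto x_{03}$. For $i\in\mathbb N$ define the following elements of $L(\mathfrak{sl}_2)^+$: $$A_i^{\downarrow\uparrow}=-x\otimes(-t)^i,\qquad B_i^{\downarrow\uparrow}=(y\otimes t+z\otimes(t-1))(-t)^i,\qquad \psi_i^{\downarrow\uparrow}=-y\otimes(-t)^i.$$ Theorem. The homomorphism $\sigma\circ\iota:O\to L(\mathfrak{sl}_2)^+$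 is injective; regard $O$ as a Lie subalgebra of $L(\mathfrak{sl}_2)^+$ by means of it. Then $O$ has the basis $$A_i^{\downarrow\uparrow},\qquad B_i^{\downarrow\uparrow},\qquad \psi_{i+1}^{\downarrow\uparrow}\qquad(i\in\mathbb N),$$ where $A_0^{\downarrow\uparrow}=-A$ and $B_0^{\downarrow\uparrow}=B$. For every $i\in\mathbb N$, the elements of $\boxtimes$ that correspond to $A_i^{\downarrow\uparrow}$, $B_i^{\downarrow\uparrow}$, $\psi_{i+1}^{\downarrow\uparrow}$ under $\iota$ are $x_{21}$-like, $x_{03}$-like and $x_{32}$-like, respectively. Moreover, for all $i,j\in\mathbb N$, $$[A_i^{\downarrow\uparrow},A_j^{\downarrow\uparrow}]=0,\qquad [B_i^{\downarrow\uparrow},B_j^{\downarrow\uparrow}]=0,\qquad [\psi_i^{\downarrow\uparrow},\psi_j^{\downarrow\uparrow}]=0,$$ $$[\psi_i^{\downarrow\uparrow},A_j^{\downarrow\uparrow}]=2\psi_{i+j}^{\downarrow\uparrow}+2A_{i+j}^{\downarrow\uparrow},\qquad [B_i^{\downarrow\uparrow},\psi_j^{\downarrow\uparrow}]=2B_{i+j}^{\downarrow\uparrow}+2\psi_{i+j}^{\downarrow\uparrow},$$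 $$[A_i^{\downarrow\uparrow},B_j^{\downarrow\uparrow}]=2A_{i+j}^{\downarrow\uparrow}+2B_{i+j}^{\downarrow\uparrow}-4\psi_{i+j+1}^{\downarrow\uparrow}.$$ -/

import Mathlib

open scoped TensorProduct

noncomputable section

namespace OnsagerLie

/-! ### Lie algebras given by generators and relations -/

/-- The Lie algebra over `F` with generating set `X` and defining relations `r = 0`, `r ∈ rels`. -/
def Presented (F : Type*) [CommRing F] {X : Type*} (rels : Set (FreeLieAlgebra F X)) : Type _ :=
  FreeLieAlgebra F X ⧸ LieSubmodule.lieSpan F (FreeLieAlgebra F X) rels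

namespace Presented

variable {F : Type*} [CommRing F] {X : Type*} (rels : Set (FreeLieAlgebra F X))

instance : LieRing (Presented F rels) :=
  inferInstanceAs (LieRing (FreeLieAlgebra F X ⧸ LieSubmodule.lieSpan F (FreeLieAlgebra F X) rels))

instance : LieAlgebra F (Presented F rels) :=
  inferInstanceAs
    (LieAlgebra F (FreeLieAlgebra F X ⧸ LieSubmodule.lieSpan F (FreeLieAlgebra F X) rels))

/-- The quotient map. -/
def mk : FreeLieAlgebra F X →ₗ⁅F⁆ Presented F rels where
  toLinearMap := (LieSubmodule.lieSpan F (FreeLieAlgebra F X) rels).toSubmodule.mkQ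
  map_lie' := rfl

theorem mk_surjective : Function.Surjective (mk rels) := Submodule.mkQ_surjective _

/-- The image of a generator. -/
def of (a : X) : Presented F rels := mk rels (FreeLieAlgebra.of F a)

variable {rels} in
theorem mk_eq_zero {r : FreeLieAlgebra F X} (hr : r ∈ rels) : mk rels r = 0 :=
  (Submodule.Quotient.mk_eq_zero _).2 (LieSubmodule.subset_lieSpan hr)

variable {L : Type*} [LieRing L] [LieAlgebra F L]

/-- The universal property: a map on generators that respects the relations extends to a
homomorphism of Lie algebras. -/
def lift (f : X → L) (hf : ∀ r ∈ rels, FreeLieAlgebra.lift F f r = 0) :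
    Presented F rels →ₗ⁅F⁆ L where
  toLinearMap := (LieSubmodule.lieSpan F (FreeLieAlgebra F X) rels).toSubmodule.liftQ
    (FreeLieAlgebra.lift F f : FreeLieAlgebra F X →ₗ[F] L) (by
      have h : LieSubmodule.lieSpan F (FreeLieAlgebra F X) rels ≤ (FreeLieAlgebra.lift F f).ker :=
        LieSubmodule.lieSpan_le.2 fun r hr => LieHom.mem_ker.2 (hf r hr)
      intro r hr
      exact LieHom.mem_ker.1 (h hr))
  map_lie' := by
    intro a b
    obtain ⟨a, rfl⟩ := mk_surjective rels a
    obtain ⟨b, rfl⟩ := mk_surjective rels b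
    exact (FreeLieAlgebra.lift F f).map_lie a b

theorem lift_of (f : X → L) (hf : ∀ r ∈ rels, FreeLieAlgebra.lift F f r = 0) (a : X) :
    lift rels f hf (of rels a) = f a :=
  FreeLieAlgebra.lift_of_apply f a

end Presented

/-! ### The Onsager Lie algebra -/

/-- The two standard generators of the Onsager Lie algebra. -/
inductive OnsagerGen : Type
  | A
  | B

/-- The defining relations of the Onsager Lie algebra (the Dolan-Grady relations):
`[A,[A,[A,B]]] = 4[A,B]` and `[B,[B,[B,A]]] = 4[B,A]`. -/
def onsagerRels (F : Type*) [CommRing F] : Set (FreeLieAlgebra F OnsagerGen) :=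
  let a := FreeLieAlgebra.of F OnsagerGen.A
  let b := FreeLieAlgebra.of F OnsagerGen.B
  {⁅a, ⁅a, ⁅a, b⁆⁆⁆ - (4 : F) • ⁅a, b⁆, ⁅b, ⁅b, ⁅b, a⁆⁆⁆ - (4 : F) • ⁅b, a⁆}

/-- The Onsager Lie algebra `O`. -/
abbrev Onsager (F : Type*) [CommRing F] : Type _ := Presented F (onsagerRels F)

namespace Onsager

/-- The standard generator `A` of `O`. -/
def A (F : Type*) [CommRing F] : Onsager F := Presented.of _ OnsagerGen.A

/-- The standard generator `B` of `O`. -/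
def B (F : Type*) [CommRing F] : Onsager F := Presented.of _ OnsagerGen.B

end Onsager

/-! ### The tetrahedron algebra -/

/-- The index set of the standard generators: pairs of distinct elements of `{0, 1, 2, 3}`. -/
abbrev TetGen : Type := {p : Fin 4 × Fin 4 // p.1 ≠ p.2}

/-- The generator `x_ij` in the free Lie algebra. -/
def freeX (F : Type*) [CommRing F] (i j : Fin 4) (h : i ≠ j) : FreeLieAlgebra F TetGen :=
  FreeLieAlgebra.of F ⟨(i, j), h⟩

/-- The defining relations of the tetrahedron algebra. -/
inductive TetRel (F : Type*) [CommRing F] : FreeLieAlgebra F TetGen → Prop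
  /-- `x_ij + x_ji = 0` -/
  | skew (i j : Fin 4) (hij : i ≠ j) :
      TetRel F (freeX F i j hij + freeX F j i hij.symm)
  /-- `[x_ij, x_jk] = 2 x_ij + 2 x_jk` -/
  | triangle (i j k : Fin 4) (hij : i ≠ j) (hjk : j ≠ k) (hik : i ≠ k) :
      TetRel F (⁅freeX F i j hij, freeX F j k hjk⁆
        - ((2 : F) • freeX F i j hij + (2 : F) • freeX F j k hjk))
  /-- `[x_ij, [x_ij, [x_ij, x_kh]]] = 4 [x_ij, x_kh]` -/
  | dolanGrady (h i j k : Fin 4) (hij : i ≠ j) (hkh : k ≠ h) (hki : k ≠ i) (hkj : k ≠ j)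
      (hhi : h ≠ i) (hhj : h ≠ j) :
      TetRel F (⁅freeX F i j hij, ⁅freeX F i j hij, ⁅freeX F i j hij, freeX F k h hkh⁆⁆⁆
        - (4 : F) • ⁅freeX F i j hij, freeX F k h hkh⁆)

/-- The tetrahedron algebra `⊠`. -/
abbrev Tet (F : Type*) [CommRing F] : Type _ := Presented F {r | TetRel F r}

namespace Tet

/-- The standard generator `x_ij` of `⊠`. -/
def x (F : Type*) [CommRing F] (i j : Fin 4) (h : i ≠ j := by decide) : Tet F :=
  Presented.of _ ⟨(i, j), h⟩

/-- `ξ ∈ ⊠` is `x_ij`-like when it commutes with `x_ij` and satisfies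
`[x_kh, [x_kh, [x_kh, ξ]]] = 4 [x_kh, ξ]` whenever `h, i, j, k` are mutually distinct. -/
def IsLike {F : Type*} [CommRing F] (i j : Fin 4) (hij : i ≠ j) (ξ : Tet F) : Prop :=
  ⁅x F i j hij, ξ⁆ = 0 ∧
    ∀ (k h : Fin 4) (hkh : k ≠ h), k ≠ i → k ≠ j → h ≠ i → h ≠ j →
      ⁅x F k h hkh, ⁅x F k h hkh, ⁅x F k h hkh, ξ⁆⁆⁆ = (4 : F) • ⁅x F k h hkh, ξ⁆

/-- The homomorphism `O → ⊠` with `A ↦ x_12`, `B ↦ x_03`. -/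
def ofOnsager (F : Type*) [CommRing F] : Onsager F →ₗ⁅F⁆ Tet F :=
  Presented.lift _
    (fun g => match g with
      | OnsagerGen.A => x F 1 2
      | OnsagerGen.B => x F 0 3)
    (by
      intro r hr
      have key : ∀ (h i j k : Fin 4) (hij : i ≠ j) (hkh : k ≠ h) (_ : k ≠ i) (_ : k ≠ j)
          (_ : h ≠ i) (_ : h ≠ j),
          ⁅x F i j hij, ⁅x F i j hij, ⁅x F i j hij, x F k h hkh⁆⁆⁆
            - (4 : F) • ⁅x F i j hij, x F k h hkh⁆ = 0 := by
        intro h i j k hij hkh h1 h2 h3 h4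
        have := Presented.mk_eq_zero (rels := {r | TetRel F r})
          (TetRel.dolanGrady (F := F) h i j k hij hkh h1 h2 h3 h4)
        simpa [freeX, x, Presented.of] using this
      rcases hr with rfl | rfl
      · simpa using key 3 1 2 0 (by decide) (by decide) (by decide) (by decide) (by decide)
          (by decide)
      · simpa using key 2 0 3 1 (by decide) (by decide) (by decide) (by decide) (by decide)
          (by decide))

end Tet

/-! ### The three-point `sl₂` loop algebra -/

/-- The algebra `𝒜 = F[t, t⁻¹, (t - 1)⁻¹]`. -/
abbrev LaurentAlg (F : Type*) [Field F] : Type _ :=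
  Localization.Away (Polynomial.X * (Polynomial.X - 1) : Polynomial F)

namespace LaurentAlg

variable (F : Type*) [Field F]

/-- The indeterminate `t`, as an element of `𝒜`. -/
def t : LaurentAlg F := algebraMap (Polynomial F) (LaurentAlg F) Polynomial.X

/-- The element `t⁻¹` of `𝒜`. -/
def tInv : LaurentAlg F :=
  (t F - 1) * IsLocalization.Away.invSelf (Polynomial.X * (Polynomial.X - 1) : Polynomial F)

/-- The element `(t - 1)⁻¹` of `𝒜`. -/
def tSubOneInv : LaurentAlg F :=
  t F * IsLocalization.Away.invSelf (Polynomial.X * (Polynomial.X - 1) : Polynomial F)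

theorem t_mul_tInv : t F * tInv F = 1 := by
  have h := IsLocalization.Away.mul_invSelf (S := LaurentAlg F)
    (Polynomial.X * (Polynomial.X - 1) : Polynomial F)
  rw [map_mul, map_sub, map_one] at h
  rw [tInv, ← mul_assoc]
  exact h

theorem tSubOne_mul_tSubOneInv : (t F - 1) * tSubOneInv F = 1 := by
  rw [tSubOneInv, ← mul_assoc, mul_comm (t F - 1), mul_assoc]
  exact t_mul_tInv F

/-- `t' = 1 - t⁻¹`. -/
def t' : LaurentAlg F := 1 - tInv F

/-- `t'' = (1 - t)⁻¹`. -/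
def t'' : LaurentAlg F := -tSubOneInv F

end LaurentAlg

/-- The Lie algebra `sl₂` of traceless `2 × 2` matrices. -/
abbrev SL2 (F : Type*) [Field F] : Type _ := LieAlgebra.SpecialLinear.sl (Fin 2) F

namespace SL2

variable (F : Type*) [Field F]

/-- The standard basis element `e` of `sl₂`. -/
def e : SL2 F := ⟨!![0, 1; 0, 0], by
  exact LinearMap.mem_ker.2 (by simp [Matrix.trace, Fin.sum_univ_two])⟩

/-- The standard basis element `f` of `sl₂`. -/
def f : SL2 F := ⟨!![0, 0; 1, 0], by
  exact LinearMap.mem_ker.2 (by simp [Matrix.trace, Fin.sum_univ_two])⟩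

/-- The standard basis element `h` of `sl₂`. -/
def h : SL2 F := ⟨!![1, 0; 0, -1], by
  exact LinearMap.mem_ker.2 (by simp [Matrix.trace, Fin.sum_univ_two])⟩

/-- `x = 2e - h`, in the equitable basis `x, y, z`. -/
def x : SL2 F := (2 : F) • e F - h F

/-- `y = -2f - h`. -/
def y : SL2 F := -((2 : F) • f F) - h F

/-- `z = h`. -/
def z : SL2 F := h F

theorem lie_h_e : ⁅h F, e F⁆ = (2 : F) • e F := by
  apply Subtype.ext
  rw [LieAlgebra.SpecialLinear.sl_bracket]
  ext i j; fin_cases i <;> fin_cases j <;>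
    simp [h, e] <;> norm_num

theorem lie_h_f : ⁅h F, f F⁆ = -((2 : F) • f F) := by
  apply Subtype.ext
  rw [LieAlgebra.SpecialLinear.sl_bracket]
  ext i j; fin_cases i <;> fin_cases j <;>
    simp [h, f] <;> norm_num

theorem lie_e_f : ⁅e F, f F⁆ = h F := by
  apply Subtype.ext
  rw [LieAlgebra.SpecialLinear.sl_bracket]
  ext i j; fin_cases i <;> fin_cases j <;> simp [h, e, f]

theorem lie_x_y : ⁅x F, y F⁆ = (2 : F) • x F + (2 : F) • y F := by
  simp only [x, y, lie_sub, sub_lie, lie_neg, lie_smul, smul_lie, lie_self, lie_h_f, lie_e_f,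
    ← lie_skew (e F) (h F), lie_h_e]
  module

theorem lie_y_z : ⁅y F, z F⁆ = (2 : F) • y F + (2 : F) • z F := by
  simp only [y, z, sub_lie, neg_lie, smul_lie, lie_self, ← lie_skew (f F) (h F), lie_h_f]
  module

theorem lie_z_x : ⁅z F, x F⁆ = (2 : F) • z F + (2 : F) • x F := by
  simp only [x, z, lie_sub, lie_smul, lie_self, lie_h_e]
  module

end SL2

/-- The three-point loop algebra `L(sl₂)⁺`: the vector space `𝒜 ⊗ sl₂` with
`[a ⊗ u, b ⊗ v] = ab ⊗ [u, v]`. (The scalars from `𝒜` are written on the left here.) -/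
def Loop (F : Type*) [Field F] : Type _ := LaurentAlg F ⊗[F] SL2 F

namespace Loop

instance (F : Type*) [Field F] : LieRing (Loop F) :=
  inferInstanceAs (LieRing (LaurentAlg F ⊗[F] SL2 F))

instance (F : Type*) [Field F] : LieAlgebra F (Loop F) :=
  inferInstanceAs (LieAlgebra F (LaurentAlg F ⊗[F] SL2 F))

variable {F : Type*} [Field F]

/-- The element usually written `u ⊗ a`, for `u ∈ sl₂` and `a ∈ 𝒜`. -/
def tens (u : SL2 F) (a : LaurentAlg F) : Loop F := a ⊗ₜ[F] u

theorem lie_tens (u v : SL2 F) (a b : LaurentAlg F) :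
    ⁅tens u a, tens v b⁆ = tens ⁅u, v⁆ (a * b) := rfl

theorem tens_add (u : SL2 F) (a b : LaurentAlg F) : tens u (a + b) = tens u a + tens u b :=
  TensorProduct.add_tmul a b u

theorem tens_neg (u : SL2 F) (a : LaurentAlg F) : tens u (-a) = -tens u a :=
  TensorProduct.neg_tmul a u

theorem tens_zero (u : SL2 F) : tens u 0 = 0 :=
  TensorProduct.zero_tmul _ u

theorem tens_sub (u : SL2 F) (a b : LaurentAlg F) : tens u (a - b) = tens u a - tens u b := by
  rw [sub_eq_add_neg, tens_add, tens_neg, sub_eq_add_neg]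

theorem add_tens (u v : SL2 F) (a : LaurentAlg F) : tens (u + v) a = tens u a + tens v a :=
  TensorProduct.tmul_add a u v

theorem neg_tens (u : SL2 F) (a : LaurentAlg F) : tens (-u) a = -tens u a :=
  TensorProduct.tmul_neg a u

theorem zero_tens (a : LaurentAlg F) : tens (0 : SL2 F) a = 0 :=
  TensorProduct.tmul_zero _ a

open LaurentAlg in
/-- The images of the standard generators of `⊠` in `L(sl₂)⁺`. -/
def genImage (F : Type*) [Field F] : Fin 4 → Fin 4 → Loop F
  | 1, 2 => tens (SL2.x F) 1
  | 2, 3 => tens (SL2.y F) 1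
  | 3, 1 => tens (SL2.z F) 1
  | 0, 3 => tens (SL2.y F) (t F) + tens (SL2.z F) (t F - 1)
  | 0, 1 => tens (SL2.z F) (t' F) + tens (SL2.x F) (t' F - 1)
  | 0, 2 => tens (SL2.x F) (t'' F) + tens (SL2.y F) (t'' F - 1)
  | 2, 1 => -tens (SL2.x F) 1
  | 3, 2 => -tens (SL2.y F) 1
  | 1, 3 => -tens (SL2.z F) 1
  | 3, 0 => -(tens (SL2.y F) (t F) + tens (SL2.z F) (t F - 1))
  | 1, 0 => -(tens (SL2.z F) (t' F) + tens (SL2.x F) (t' F - 1))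
  | 2, 0 => -(tens (SL2.x F) (t'' F) + tens (SL2.y F) (t'' F - 1))
  | _, _ => 0

/-- The element with coordinates `a, b, c` in the equitable basis. -/
def elt (a b c : LaurentAlg F) : Loop F :=
  tens (SL2.x F) a + tens (SL2.y F) b + tens (SL2.z F) c

theorem elt_add (a b c a' b' c' : LaurentAlg F) :
    elt a b c + elt a' b' c' = elt (a + a') (b + b') (c + c') := by
  simp only [elt, tens_add]; abel

theorem elt_sub (a b c a' b' c' : LaurentAlg F) :
    elt a b c - elt a' b' c' = elt (a - a') (b - b') (c - c') := by
  simp only [elt, tens_sub]; abel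

theorem two_smul_elt (a b c : LaurentAlg F) :
    (2 : F) • elt a b c = elt (2 * a) (2 * b) (2 * c) := by
  rw [two_smul, elt_add]; simp only [two_mul]

theorem four_smul_elt (a b c : LaurentAlg F) :
    (4 : F) • elt a b c = elt (4 * a) (4 * b) (4 * c) := by
  rw [show (4 : F) = 2 * 2 by norm_num, mul_smul, two_smul_elt, two_smul_elt]
  congr 1 <;> ring

theorem elt_zero : elt (0 : LaurentAlg F) 0 0 = 0 := by simp [elt, tens_zero]

theorem lie_elt (a b c a' b' c' : LaurentAlg F) :
    ⁅elt a b c, elt a' b' c'⁆ =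
      elt (2 * (a * b' - b * a') + 2 * (c * a' - a * c'))
        (2 * (a * b' - b * a') + 2 * (b * c' - c * b'))
        (2 * (b * c' - c * b') + 2 * (c * a' - a * c')) := by
  simp only [elt, add_lie, lie_add, lie_tens, lie_self, SL2.lie_x_y, SL2.lie_y_z, SL2.lie_z_x,
    ← lie_skew (SL2.y F) (SL2.x F), ← lie_skew (SL2.z F) (SL2.y F),
    ← lie_skew (SL2.x F) (SL2.z F)]
  simp only [two_smul, two_mul, add_tens, neg_tens, zero_tens, tens_add, tens_sub]
  abel

/-- The coordinates of `genImage` in the equitable basis, where `u = t⁻¹` and `v = (t - 1)⁻¹`. -/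
def genCoord {R : Type*} [CommRing R] (t u v : R) : Fin 4 → Fin 4 → R × R × R
  | 1, 2 => (1, 0, 0)
  | 2, 3 => (0, 1, 0)
  | 3, 1 => (0, 0, 1)
  | 0, 3 => (0, t, t - 1)
  | 0, 1 => (-u, 0, 1 - u)
  | 0, 2 => (-v, -v - 1, 0)
  | 2, 1 => (-1, 0, 0)
  | 3, 2 => (0, -1, 0)
  | 1, 3 => (0, 0, -1)
  | 3, 0 => (0, -t, 1 - t)
  | 1, 0 => (u, 0, u - 1)
  | 2, 0 => (v, v + 1, 0)
  | _, _ => (0, 0, 0)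

/-- The bracket in equitable coordinates. -/
def coordLie {R : Type*} [CommRing R] (p q : R × R × R) : R × R × R :=
  (2 * (p.1 * q.2.1 - p.2.1 * q.1) + 2 * (p.2.2 * q.1 - p.1 * q.2.2),
    2 * (p.1 * q.2.1 - p.2.1 * q.1) + 2 * (p.2.1 * q.2.2 - p.2.2 * q.2.1),
    2 * (p.2.1 * q.2.2 - p.2.2 * q.2.1) + 2 * (p.2.2 * q.1 - p.1 * q.2.2))

theorem coordLie_cube {R : Type*} [CommRing R] (a b c : R) (q : R × R × R)
    (hN : a ^ 2 + b ^ 2 + c ^ 2 - 2 * a * b - 2 * b * c - 2 * c * a = 1) :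
    coordLie (a, b, c) (coordLie (a, b, c) (coordLie (a, b, c) q)) =
      4 * coordLie (a, b, c) q := by
  obtain ⟨d, e, f⟩ := q
  simp only [coordLie, Prod.ext_iff, Prod.fst_mul, Prod.snd_mul, Prod.fst_ofNat, Prod.snd_ofNat]
  refine ⟨?_, ?_, ?_⟩
  · linear_combination (4 * (2 * (a * e - b * d) + 2 * (c * d - a * f))) * hN
  · linear_combination (4 * (2 * (a * e - b * d) + 2 * (b * f - c * e))) * hN
  · linear_combination (4 * (2 * (b * f - c * e) + 2 * (c * d - a * f))) * hN

theorem genCoord_dolanGrady {R : Type*} [CommRing R] (t u v : R) (i j : Fin 4) (hij : i ≠ j)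
    (q : R × R × R) :
    coordLie (genCoord t u v i j) (coordLie (genCoord t u v i j)
        (coordLie (genCoord t u v i j) q)) = 4 * coordLie (genCoord t u v i j) q := by
  fin_cases i <;> fin_cases j <;> first | exact absurd rfl hij | skip
  all_goals exact coordLie_cube _ _ _ q (by ring1)

theorem genCoord_triangle {R : Type*} [CommRing R] (t u v : R) (h1 : t * u = 1)
    (h2 : (t - 1) * v = 1) (i j k : Fin 4) (hij : i ≠ j) (hjk : j ≠ k) (hik : i ≠ k) :
    coordLie (genCoord t u v i j) (genCoord t u v j k) =
      2 * genCoord t u v i j + 2 * genCoord t u v j k := by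
  have key : ∀ a b c a' b' c' : R,
      2 * (a * b' - b * a') + 2 * (c * a' - a * c') = 2 * a + 2 * a' →
      2 * (a * b' - b * a') + 2 * (b * c' - c * b') = 2 * b + 2 * b' →
      2 * (b * c' - c * b') + 2 * (c * a' - a * c') = 2 * c + 2 * c' →
      coordLie (a, b, c) (a', b', c') = 2 * (a, b, c) + 2 * (a', b', c') := by
    intro a b c a' b' c' e1 e2 e3
    exact Prod.ext e1 (Prod.ext e2 e3)
  fin_cases i <;> fin_cases j <;> first | exact absurd rfl hij | skip
  all_goals fin_cases k <;> first | exact absurd rfl hjk | exact absurd rfl hik | skip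
  all_goals
    refine key _ _ _ _ _ _ ?_ ?_ ?_ <;> clear key hij hjk hik <;> first | ring1 | grind

/-- The element with a given triple of equitable coordinates. -/
def ofCoord (p : LaurentAlg F × LaurentAlg F × LaurentAlg F) : Loop F := elt p.1 p.2.1 p.2.2

theorem lie_ofCoord (p q : LaurentAlg F × LaurentAlg F × LaurentAlg F) :
    ⁅ofCoord p, ofCoord q⁆ = ofCoord (coordLie p q) := lie_elt _ _ _ _ _ _

theorem genImage_eq (i j : Fin 4) : genImage F i j =
    ofCoord (genCoord (LaurentAlg.t F) (LaurentAlg.tInv F) (LaurentAlg.tSubOneInv F) i j) := by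
  fin_cases i <;> fin_cases j <;>
    simp [genImage, genCoord, ofCoord, elt, tens_add, tens_sub, tens_neg, tens_zero,
      LaurentAlg.t', LaurentAlg.t''] <;> try abel

theorem genImage_skew (i j : Fin 4) : genImage F i j + genImage F j i = 0 := by
  rw [genImage_eq, genImage_eq, ofCoord, ofCoord, elt_add, ← elt_zero]
  fin_cases i <;> fin_cases j <;> simp [genCoord]

theorem genImage_triangle (i j k : Fin 4) (hij : i ≠ j) (hjk : j ≠ k) (hik : i ≠ k) :
    ⁅genImage F i j, genImage F j k⁆ = (2 : F) • genImage F i j + (2 : F) • genImage F j k := by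
  rw [genImage_eq, genImage_eq, lie_ofCoord, genCoord_triangle _ _ _ (LaurentAlg.t_mul_tInv F)
    (LaurentAlg.tSubOne_mul_tSubOneInv F) i j k hij hjk hik]
  simp only [ofCoord, two_smul_elt, elt_add]
  rfl

theorem genImage_dolanGrady (h i j k : Fin 4) (hij : i ≠ j) :
    ⁅genImage F i j, ⁅genImage F i j, ⁅genImage F i j, genImage F k h⁆⁆⁆ =
      (4 : F) • ⁅genImage F i j, genImage F k h⁆ := by
  rw [genImage_eq, genImage_eq, lie_ofCoord, lie_ofCoord, lie_ofCoord,
    genCoord_dolanGrady _ _ _ i j hij]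
  simp only [ofCoord, four_smul_elt]
  rfl

/-- The homomorphism `σ : ⊠ → L(sl₂)⁺` that sends
`x_12 ↦ x ⊗ 1`, `x_23 ↦ y ⊗ 1`, `x_31 ↦ z ⊗ 1`, `x_03 ↦ y ⊗ t + z ⊗ (t - 1)`,
`x_01 ↦ z ⊗ t' + x ⊗ (t' - 1)`, `x_02 ↦ x ⊗ t'' + y ⊗ (t'' - 1)`. -/
def sigma (F : Type*) [Field F] : Tet F →ₗ⁅F⁆ Loop F :=
  Presented.lift _ (fun p => genImage F p.1.1 p.1.2) (by
    intro r hr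
    cases hr with
    | skew i j hij => simpa [freeX] using genImage_skew i j
    | triangle i j k hij hjk hik =>
      simpa [freeX, sub_eq_zero] using genImage_triangle i j k hij hjk hik
    | dolanGrady h i j k hij hkh hki hkj hhi hhj =>
      simpa [freeX, sub_eq_zero] using genImage_dolanGrady h i j k hij)

theorem sigma_x (i j : Fin 4) (h : i ≠ j) : sigma F (Tet.x F i j h) = genImage F i j :=
  Presented.lift_of _ _ _ _

/-- The homomorphism `O → ⊠ → L(sl₂)⁺` by which `O` is regarded as a subalgebra of `L(sl₂)⁺`:
it sends `A ↦ x ⊗ 1` and `B ↦ y ⊗ t + z ⊗ (t - 1)`. -/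
def ofOnsager (F : Type*) [Field F] : Onsager F →ₗ⁅F⁆ Loop F :=
  (sigma F).comp (Tet.ofOnsager F)

/-- `A_i = -x ⊗ (-t)^i`. -/
def A (F : Type*) [Field F] (i : ℕ) : Loop F :=
  -tens (SL2.x F) ((-LaurentAlg.t F) ^ i)

/-- `B_i = (y ⊗ t + z ⊗ (t - 1)) (-t)^i`. -/
def B (F : Type*) [Field F] (i : ℕ) : Loop F :=
  tens (SL2.y F) (LaurentAlg.t F * (-LaurentAlg.t F) ^ i)
    + tens (SL2.z F) ((LaurentAlg.t F - 1) * (-LaurentAlg.t F) ^ i)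

/-- `ψ_i = -y ⊗ (-t)^i`. -/
def psi (F : Type*) [Field F] (i : ℕ) : Loop F :=
  -tens (SL2.y F) ((-LaurentAlg.t F) ^ i)

/-- The family `A_i, B_i, ψ_{i+1}` (`i ∈ ℕ`) in `L(sl₂)⁺`. -/
def family (F : Type*) [Field F] : ℕ ⊕ ℕ ⊕ ℕ → Loop F
  | .inl i => A F i
  | .inr (.inl i) => B F i
  | .inr (.inr i) => psi F (i + 1)

end Loop

end OnsagerLie

end

/-! Two bounds meet. From above: the Dolan-Grady relations are invariant under the reflection `b ↦ b
- ½ [a, [a, b]]` and under exchange of the generators. The composite of these two involutions is a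
translation automorphism of `O`, and the orbit of `A` under it is a sequence `A_n` (`n ∈ ℤ`) with
`A_0 = A`, `A_1 = B`. Onsager's relations `[A_l, A_m] = G_{l-m}` and `[G_k, A_n] = 2 A_{n+k} - 2
A_{n-k}` follow (`onsager_relations`), so `O` is the union of subspaces `filt F N`, each spanned by
`3(N+1)` elements.

From below: in `L(sl₂)⁺`, multiplication by `2 - 4t` sends the image of `A_n` to the sum of the
images of its two neighbours (`mulA_seq`), so multiplication by `-t` maps the image of `filt F N`
into that of `filt F (N+1)`. Starting from `A_0`, `B_0`, `ψ_1`, this puts `A_i`, `B_i`, `ψ_{i+1}`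
with `i ≤ N` in the image of `filt F N`. These are `3(N+1)` independent vectors, so the map is
injective on `filt F N` and they span its image (`filt_spec`). Injectivity and the basis follow.

The likeness conditions live in `⊠`, and injectivity of `σ` on all of `⊠` is not used. For `A_i` and
`B_i` everything happens inside `O`. For `ψ_{i+1}` the generators `x_23` and `x_01` lie outside `O`,
but the sum of `O` and the line through either of them is stable under the bracket with that
generator, and `σ` is still injective on this sum (`sigma_inj`). Identities that are checked in
`L(sl₂)⁺` therefore pull back. -/

noncomputable section

namespace OnsagerLie

/-! ### Homomorphisms on a presented Lie algebra are determined by the generators -/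

namespace Presented

variable {F : Type*} [CommRing F] {X : Type*} {rels : Set (FreeLieAlgebra F X)}

/-- A Lie subalgebra that contains the generators is everything. -/
theorem eq_top_of_of_mem (K : LieSubalgebra F (Presented F rels)) (h : ∀ a, of rels a ∈ K)
    (u : Presented F rels) : u ∈ K := by
  obtain ⟨u, rfl⟩ := mk_surjective rels u
  let g : FreeLieAlgebra F X →ₗ⁅F⁆ K := FreeLieAlgebra.lift F fun a => ⟨of rels a, h a⟩
  have hg : K.incl.comp g = mk rels := by
    refine FreeLieAlgebra.hom_ext fun a => ?_
    simp [g, of]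
  rw [← hg]
  exact (g u).2

theorem hom_ext {L : Type*} [LieRing L] [LieAlgebra F L] {φ ψ : Presented F rels →ₗ⁅F⁆ L}
    (h : ∀ a, φ (of rels a) = ψ (of rels a)) (u : Presented F rels) : φ u = ψ u := by
  obtain ⟨u, rfl⟩ := mk_surjective rels u
  have : φ.comp (mk rels) = ψ.comp (mk rels) := FreeLieAlgebra.hom_ext h
  exact DFunLike.congr_fun this u

end Presented

/-! ### Sequences generated by the Onsager recursion -/

section Recursion

variable {F : Type*} [Field F] [CharZero F] {L : Type*} [LieRing L] [LieAlgebra F L] {a : ℤ → L}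

/-- If `[g, a_n] = 2 a_{n+1} - 2 a_{n-1}` and `[a_{n+1}, a_n] = g` for all `n`, then the remaining
relations of the Onsager algebra hold. -/
theorem onsager_relations (hg : ∀ n, ⁅⁅a 1, a 0⁆, a n⁆ = (2 : F) • a (n + 1) - (2 : F) • a (n - 1))
    (h1 : ∀ n, ⁅a (n + 1), a n⁆ = ⁅a 1, a 0⁆) (k : ℕ) :
    (∀ l, ⁅a (l + k), a l⁆ = ⁅a k, a 0⁆) ∧
      ∀ n, ⁅⁅a k, a 0⁆, a n⁆ = (2 : F) • a (n + k) - (2 : F) • a (n - k) := by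
  induction k using Nat.twoStepInduction with
  | zero => simp
  | one => exact ⟨by simpa using h1, by simpa using hg⟩
  | more k ih0 ih1 =>
    obtain ⟨i0, j0⟩ := ih0
    obtain ⟨i1, j1⟩ := ih1
    push_cast at i0 j0 i1 j1 ⊢
    set g := ⁅a 1, a 0⁆ with hgdef
    set G := ⁅a (k + 1), a 0⁆
    set G' := ⁅a k, a 0⁆
    -- Leibniz on `G = [a_{l+k+1}, a_l]`: the two inner brackets have index difference `k`, both
    -- equal `G'`, and cancel.
    have step : ∀ l, ⁅g, G⁆ = (2 : F) • ⁅a (l + (k + 2)), a l⁆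
        - (2 : F) • ⁅a (l - 1 + (k + 2)), a (l - 1)⁆ := by
      intro l
      have e1 := i0 l
      have e2 := i0 (l + 1)
      rw [← i1 l, leibniz_lie, hg, hg, sub_lie, lie_sub, smul_lie, smul_lie, lie_smul, lie_smul,
        show l + (k + 1) - 1 = l + (k : ℤ) by ring, e1,
        show l + ((k : ℤ) + 1) = l + 1 + k by ring, e2,
        show l - 1 + ((k : ℤ) + 2) = l + 1 + k by ring, show l + 1 + (k : ℤ) + 1 = l + (k + 2) by ring]
      abel
    have iter : ∀ m : ℕ, (m : F) • ⁅g, G⁆ = (2 : F) • ⁅a (0 + (k + 2)), a 0⁆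
        - (2 : F) • ⁅a (-m + (k + 2)), a (-m)⁆ := by
      intro m
      induction m with
      | zero => simp
      | succ m ih =>
        have := step (-m)
        push_cast
        rw [add_smul, ih, one_smul, this, neg_add', sub_add_sub_cancel]
    -- The same bracket from the other side, with `ad G` acting on `g = [a_1, a_0]`. The result is
    -- the right side of `iter` at `m = k + 1`, so `(k+1) [g, G] = [G, g] = -[g, G]`; characteristic
    -- zero then forces `[g, G] = 0`.
    have other : ⁅G, g⁆ = (2 : F) • ⁅a (0 + (k + 2)), a 0⁆
        - (2 : F) • ⁅a (-(k + 1 : ℕ) + (k + 2)), a (-(k + 1 : ℕ))⁆ := by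
      have e1 := i0 1
      have e2 := i0 (-k)
      rw [neg_add_cancel] at e2
      rw [hgdef, leibniz_lie, j1, j1, sub_lie, lie_sub, smul_lie, smul_lie, lie_smul, lie_smul,
        zero_add, zero_sub, ← lie_skew (a (1 - (k + 1))) (a 0), ← lie_skew (a 1) (a (k + 1))]
      rw [show (1 : ℤ) - (k + 1) = -k by ring, e2, show (k : ℤ) + 1 = 1 + k by ring, e1]
      push_cast
      rw [show -((k : ℤ) + 1) + (k + 2) = 1 by ring, show (1 : ℤ) + (1 + k) = 0 + (k + 2) by ring,
        show -(1 + (k : ℤ)) = -(k + 1) by ring]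
      module
    have comm : ⁅g, G⁆ = 0 := by
      have h2 : ((k + 2 : ℕ) : F) • ⁅g, G⁆ = 0 := by
        have h3 := iter (k + 1)
        rw [← other, ← lie_skew g G] at h3
        push_cast at h3 ⊢
        rw [show (k : F) + 2 = k + 1 + 1 by ring, ← lie_skew g G, add_smul, h3, one_smul,
          add_neg_cancel]
      exact (smul_eq_zero.1 h2).resolve_left (Nat.cast_ne_zero.2 (by omega))
    have inv : ∀ l, ⁅a (l + (k + 2)), a l⁆ = ⁅a (l - 1 + (k + 2)), a (l - 1)⁆ := by
      intro l
      have h2 := step l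
      rw [comm, ← smul_sub] at h2
      exact sub_eq_zero.1 ((smul_eq_zero.1 h2.symm).resolve_left two_ne_zero)
    have inv' : ∀ l, ⁅a (l + (k + 2)), a l⁆ = ⁅a (k + 2), a 0⁆ := by
      intro l
      induction l with
      | zero => simp
      | succ i ih => rw [inv, ← ih]; simp
      | pred i ih => rw [← inv, ← ih]
    refine ⟨inv', fun n => ?_⟩
    -- The target is `(ad a_n)²` applied to `a_{n+k+2}`. By `q3` this element is `a_{n+k} + ½ [g,
    -- a_{n+k+1}]`; `q0` treats the first term, and `q5` treats the second by Leibniz and `[g, G] =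
    -- 0`.
    have q0 : ⁅a n, ⁅a n, a (n + k)⁆⁆ = (2 : F) • a (n + k) - (2 : F) • a (n - k) := by
      rw [← lie_skew (a n) (a (n + k)), i0, lie_neg, lie_skew, j0]
    have q1 : ⁅a n, a (n + (k + 1))⁆ = -G := by rw [← lie_skew, i1]
    have q2 : ⁅a n, g⁆ = -((2 : F) • a (n + 1) - (2 : F) • a (n - 1)) := by rw [← lie_skew, hg]
    have q3 : a (n + (k + 2)) = a (n + k) + (2⁻¹ : F) • ⁅g, a (n + (k + 1))⁆ := by
      rw [hg, show n + ((k : ℤ) + 1) + 1 = n + (k + 2) by ring,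
        show n + ((k : ℤ) + 1) - 1 = n + k by ring]
      module
    have q4 : ∀ m, ⁅a m, G⁆ = -((2 : F) • a (m + (k + 1)) - (2 : F) • a (m - (k + 1))) := by
      intro m; rw [← lie_skew, j1]
    have q5 : ⁅a n, ⁅a n, ⁅g, a (n + (k + 1))⁆⁆⁆ =
        (4 : F) • a (n + (k + 2)) - (4 : F) • a (n + k) - (4 : F) • a (n - (k + 2))
          + (4 : F) • a (n - k) := by
      have r1 : ⁅a n, ⁅a n, g⁆⁆ = (4 : F) • g := by
        have e := h1 (n - 1)
        rw [sub_add_cancel] at e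
        rw [q2, lie_neg, lie_sub, lie_smul, lie_smul, e, ← lie_skew, h1]
        module
      rw [leibniz_lie (a n) g, q1, lie_neg g, comm, neg_zero, add_zero, leibniz_lie (a n) ⁅a n, g⁆,
        r1, q1, q2, smul_lie, hg, lie_neg, neg_lie, sub_lie, smul_lie, smul_lie, q4, q4,
        show n + ((k : ℤ) + 1) + 1 = n + (k + 2) by ring,
        show n + ((k : ℤ) + 1) - 1 = n + k by ring,
        show n + 1 + ((k : ℤ) + 1) = n + (k + 2) by ring,
        show n + 1 - ((k : ℤ) + 1) = n - k by ring,
        show n - 1 + ((k : ℤ) + 1) = n + k by ring,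
        show n - 1 - ((k : ℤ) + 1) = n - (k + 2) by ring]
      module
    rw [← inv' n, ← lie_skew, ← lie_skew (a (n + (k + 2))), lie_neg, neg_neg]
    nth_rw 1 [q3]
    rw [lie_add, lie_add, q0, lie_smul, lie_smul, q5]
    module

end Recursion

/-! ### Dolan-Grady pairs and the automorphisms of the Onsager algebra -/

namespace Onsager

variable {F : Type*} [Field F] [CharZero F] {L : Type*} [LieRing L] [LieAlgebra F L]

theorem dolanGrady_A (F : Type*) [CommRing F] :
    ⁅A F, ⁅A F, ⁅A F, B F⁆⁆⁆ = (4 : F) • ⁅A F, B F⁆ := by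
  have := Presented.mk_eq_zero (rels := onsagerRels F) (Or.inl rfl)
  simpa [sub_eq_zero, A, B, Presented.of] using this

theorem dolanGrady_B (F : Type*) [CommRing F] :
    ⁅B F, ⁅B F, ⁅B F, A F⁆⁆⁆ = (4 : F) • ⁅B F, A F⁆ := by
  have := Presented.mk_eq_zero (rels := onsagerRels F) (Or.inr rfl)
  simpa [sub_eq_zero, A, B, Presented.of] using this

/-- A pair that satisfies the Dolan-Grady relations gives a homomorphism on `O`. -/
def lift {F : Type*} [CommRing F] {L : Type*} [LieRing L] [LieAlgebra F L] (a b : L)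
    (hab : ⁅a, ⁅a, ⁅a, b⁆⁆⁆ = (4 : F) • ⁅a, b⁆) (hba : ⁅b, ⁅b, ⁅b, a⁆⁆⁆ = (4 : F) • ⁅b, a⁆) :
    Onsager F →ₗ⁅F⁆ L :=
  Presented.lift _ (fun g => match g with
    | OnsagerGen.A => a
    | OnsagerGen.B => b) (by
      intro r hr
      rcases hr with rfl | rfl
      · simpa [sub_eq_zero] using hab
      · simpa [sub_eq_zero] using hba)

section lift

variable {F : Type*} [CommRing F] {L : Type*} [LieRing L] [LieAlgebra F L] {a b : L}
  {hab : ⁅a, ⁅a, ⁅a, b⁆⁆⁆ = (4 : F) • ⁅a, b⁆} {hba : ⁅b, ⁅b, ⁅b, a⁆⁆⁆ = (4 : F) • ⁅b, a⁆}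

theorem lift_A : lift a b hab hba (A F) = a := Presented.lift_of _ _ _ _

theorem lift_B : lift a b hab hba (B F) = b := Presented.lift_of _ _ _ _

theorem hom_ext {φ ψ : Onsager F →ₗ⁅F⁆ L} (hA : φ (A F) = ψ (A F)) (hB : φ (B F) = ψ (B F))
    (u : Onsager F) : φ u = ψ u :=
  Presented.hom_ext (fun g => by cases g; exacts [hA, hB]) u

theorem mem_of_A_B_mem (K : LieSubalgebra F (Onsager F)) (hA : A F ∈ K) (hB : B F ∈ K)
    (u : Onsager F) : u ∈ K :=
  Presented.eq_top_of_of_mem K (fun g => by cases g; exacts [hA, hB]) u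

/-- A subspace that contains `A` and `B` and is stable under bracketing with them is everything. -/
theorem mem_of_lie_mem (M : Submodule F (Onsager F)) (hA : A F ∈ M) (hB : B F ∈ M)
    (hAM : ∀ m ∈ M, ⁅A F, m⁆ ∈ M) (hBM : ∀ m ∈ M, ⁅B F, m⁆ ∈ M) (u : Onsager F) : u ∈ M := by
  -- The stabilizer of `M` is a Lie subalgebra that contains the generators, hence is everything;
  -- then `M` is itself a Lie subalgebra that contains the generators.
  let N : LieSubalgebra F (Onsager F) :=
    { carrier := {u | ∀ m ∈ M, ⁅u, m⁆ ∈ M}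
      add_mem' := fun {u v} hu hv m hm => by
        rw [add_lie]; exact M.add_mem (hu m hm) (hv m hm)
      zero_mem' := fun m _ => by rw [zero_lie]; exact M.zero_mem
      smul_mem' := fun c u hu m hm => by rw [smul_lie]; exact M.smul_mem c (hu m hm)
      lie_mem' := fun {u v} hu hv m hm => by
        rw [lie_lie]; exact M.sub_mem (hu _ (hv m hm)) (hv _ (hu m hm)) }
  let K : LieSubalgebra F (Onsager F) :=
    { M with lie_mem' := fun {u v} _ hv => mem_of_A_B_mem N hAM hBM u v hv }
  exact mem_of_A_B_mem K hA hB u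

end lift

/-- The Dolan-Grady relations are stable under the reflection `b ↦ b - ½ [a, [a, b]]`. -/
theorem dolanGrady_reflect (a b : L) (hab : ⁅a, ⁅a, ⁅a, b⁆⁆⁆ = (4 : F) • ⁅a, b⁆)
    (hba : ⁅b, ⁅b, ⁅b, a⁆⁆⁆ = (4 : F) • ⁅b, a⁆) :
    ⁅b - (2⁻¹ : F) • ⁅a, ⁅a, b⁆⁆, ⁅b - (2⁻¹ : F) • ⁅a, ⁅a, b⁆⁆,
      ⁅b - (2⁻¹ : F) • ⁅a, ⁅a, b⁆⁆, a⁆⁆⁆ = (4 : F) • ⁅b - (2⁻¹ : F) • ⁅a, ⁅a, b⁆⁆, a⁆ := by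
  obtain ⟨v, hv⟩ : ∃ v, v = ⁅a, b⁆ := ⟨_, rfl⟩
  obtain ⟨w, hw⟩ : ∃ w, w = ⁅a, v⁆ := ⟨_, rfl⟩
  have e0 : ⁅b, ⁅b, v⁆⁆ = (4 : F) • v := by
    rw [← lie_skew b a, ← hv, lie_neg, lie_neg, smul_neg] at hba
    exact neg_injective hba
  rw [← hv, ← hw] at hab
  have dadd : ∀ x y : L, ⁅a, x + y⁆ = ⁅a, x⁆ + ⁅a, y⁆ := lie_add a
  -- Two applications of `ad a` to `[b, [b, v]] = 4v`, combined with the Jacobi identity, give `3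
  -- [v, [b, w]] = 0`.
  have e1 := congrArg (⁅a, ·⁆) e0
  simp only [leibniz_lie a, lie_smul, ← hv, ← hw, lie_self, zero_add] at e1
  have e2 := congrArg (⁅a, ·⁆) e1
  simp only [leibniz_lie a, dadd, lie_smul, ← hv, ← hw, hab, lie_add, lie_self, e0, zero_add] at e2
  have jac : ⁅b, ⁅v, w⁆⁆ = -⁅w, ⁅b, v⁆⁆ + ⁅v, ⁅b, w⁆⁆ := by
    rw [leibniz_lie b, ← lie_skew w]; abel
  rw [jac] at e2
  have vbw : ⁅v, ⁅b, w⁆⁆ = 0 := by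
    have : (3 : F) • ⁅v, ⁅b, w⁆⁆ = 0 := by
      rw [← sub_eq_zero] at e2
      rw [← e2]
      module
    exact (smul_eq_zero.1 this).resolve_left three_ne_zero
  -- Two more applications, now to `[v, [b, w]] = 0`, express `[w, [v, w]]` through `[w, [b, v]]`.
  -- This is the last bracket needed to expand the claim.
  have e3 := congrArg (⁅a, ·⁆) vbw
  simp only [leibniz_lie a, lie_smul, ← hv, ← hw, hab, lie_zero, lie_add v] at e3
  have e4 := congrArg (⁅a, ·⁆) e3
  simp only [leibniz_lie a, dadd, lie_smul, smul_lie, ← hv, ← hw, hab, lie_zero, lie_add, lie_self,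
    vbw, zero_add, smul_zero, add_zero] at e4
  have wvw : ⁅w, ⁅v, w⁆⁆ = -((4 : F) • ⁅w, ⁅b, v⁆⁆) := by
    have : (2 : F) • (⁅w, ⁅v, w⁆⁆ + (4 : F) • ⁅w, ⁅b, v⁆⁆) = 0 := by
      rw [← sub_eq_zero] at e4
      rw [← e4]
      module
    exact eq_neg_of_add_eq_zero_left ((smul_eq_zero.1 this).resolve_left two_ne_zero)
  have hca : ⁅b - (2⁻¹ : F) • w, a⁆ = v := by
    rw [sub_lie, smul_lie, ← lie_skew b, ← lie_skew w, hab, ← hv]; module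
  rw [← hv, ← hw, hca]
  simp only [sub_lie, lie_sub, smul_lie, lie_smul, e0, ← lie_skew w v, lie_neg, jac, vbw, wvw]
  module

/-- The automorphism that exchanges the generators, as a homomorphism. -/
def swapHom (F : Type*) [CommRing F] : Onsager F →ₗ⁅F⁆ Onsager F :=
  lift (B F) (A F) (dolanGrady_B F) (dolanGrady_A F)

/-- Since `ad a` satisfies `T³ = 4T` on `b`, the operator `1 - ½ T²` acts as `1` where `T = 0` and
as `-1` where `T = ±2`. In particular it negates `[a, b]`. -/
theorem reflect_cube {a b : L} (hab : ⁅a, ⁅a, ⁅a, b⁆⁆⁆ = (4 : F) • ⁅a, b⁆) :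
    ⁅a, b - (2⁻¹ : F) • ⁅a, ⁅a, b⁆⁆⁆ = -⁅a, b⁆ := by
  rw [lie_sub, lie_smul, hab]; module

/-- The homomorphism that fixes `A` and sends `B` to `B - ½ [A, [A, B]]`. -/
def reflectHom (F : Type*) [Field F] [CharZero F] : Onsager F →ₗ⁅F⁆ Onsager F :=
  lift (A F) (B F - (2⁻¹ : F) • ⁅A F, ⁅A F, B F⁆⁆)
    (by rw [reflect_cube (dolanGrady_A F), lie_neg, lie_neg, dolanGrady_A, smul_neg])
    (dolanGrady_reflect _ _ (dolanGrady_A F) (dolanGrady_B F))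

theorem swapHom_swapHom {F : Type*} [CommRing F] (u : Onsager F) : swapHom F (swapHom F u) = u := by
  refine hom_ext (φ := (swapHom F).comp (swapHom F)) (ψ := LieHom.id) ?_ ?_ u <;>
    simp [swapHom, lift_A, lift_B]

theorem reflectHom_reflectHom (u : Onsager F) : reflectHom F (reflectHom F u) = u := by
  have hA : reflectHom F (A F) = A F := lift_A
  have hB : reflectHom F (B F) = B F - (2⁻¹ : F) • ⁅A F, ⁅A F, B F⁆⁆ := lift_B
  refine hom_ext (φ := (reflectHom F).comp (reflectHom F)) (ψ := LieHom.id) ?_ ?_ u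
  · simp [hA]
  · simp only [LieHom.comp_apply, LieHom.id_apply, hA, hB, map_sub, map_smul, LieHom.map_lie,
      reflect_cube (dolanGrady_A F), lie_neg]
    module

/-- The translation automorphism. -/
def shift (F : Type*) [Field F] [CharZero F] : Onsager F ≃ₗ[F] Onsager F where
  toLinearMap := (swapHom F : Onsager F →ₗ[F] Onsager F) ∘ₗ (reflectHom F : Onsager F →ₗ[F] Onsager F)
  invFun u := reflectHom F (swapHom F u)
  left_inv u := by simp [swapHom_swapHom, reflectHom_reflectHom]
  right_inv u := by simp [swapHom_swapHom, reflectHom_reflectHom]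

theorem shift_apply (u : Onsager F) : shift F u = swapHom F (reflectHom F u) := rfl

theorem shift_symm_apply (u : Onsager F) : (shift F).symm u = reflectHom F (swapHom F u) := rfl

theorem shift_lie (u v : Onsager F) : shift F ⁅u, v⁆ = ⁅shift F u, shift F v⁆ := by
  simp [shift_apply]

/-! ### The Onsager sequence and its relations -/

/-- The Onsager sequence `(A_n)` with `A_0 = A` and `A_1 = B`. -/
def seq (F : Type*) [Field F] [CharZero F] (n : ℤ) : Onsager F := (shift F ^ n) (A F)

theorem seq_zero : seq F 0 = A F := by simp [seq]

theorem shift_seq (n : ℤ) : shift F (seq F n) = seq F (n + 1) := by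
  rw [seq, seq, add_comm, zpow_add, zpow_one]; rfl

theorem seq_one : seq F 1 = B F := by
  rw [← zero_add 1, ← shift_seq, seq_zero, shift_apply]
  simp [reflectHom, swapHom, lift_A]

theorem seq_neg_one : seq F (-1) = B F - (2⁻¹ : F) • ⁅A F, ⁅A F, B F⁆⁆ := by
  have h := shift_seq (F := F) (-1)
  rw [← (shift F).eq_symm_apply, neg_add_cancel, seq_zero, shift_symm_apply] at h
  rw [h]
  simp [reflectHom, swapHom, lift_A, lift_B]

/-- The reflection and the exchange of generators each negate `[B, A]`, so their composite fixes it.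
This lets a relation checked at one index be translated to all of them. -/
theorem shift_lie_B_A : shift F ⁅B F, A F⁆ = ⁅B F, A F⁆ := by
  have h : reflectHom F ⁅B F, A F⁆ = -⁅B F, A F⁆ := by
    rw [LieHom.map_lie, reflectHom, lift_A, lift_B, ← lie_skew _ (A F),
      reflect_cube (dolanGrady_A F), ← lie_skew (B F)]
  rw [shift_apply, h, map_neg, LieHom.map_lie, swapHom, lift_A, lift_B, lie_skew]

theorem lie_seq_succ (n : ℤ) : ⁅seq F (n + 1), seq F n⁆ = ⁅seq F 1, seq F 0⁆ := by
  have h : ∀ n, ⁅seq F (n + 1 + 1), seq F (n + 1)⁆ = shift F ⁅seq F (n + 1), seq F n⁆ := by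
    intro n; rw [shift_lie, shift_seq, shift_seq]
  rw [seq_zero, seq_one]
  induction n with
  | zero => simp [seq_zero, seq_one]
  | succ i ih => rw [h, ih, shift_lie_B_A]
  | pred i ih =>
    apply (shift F).injective
    rw [shift_lie_B_A, ← h, sub_add_cancel, ih]

/-- At `n = 0` this is the formula for `A_{-1}` rearranged; the translation, which fixes `[B, A]`,
carries it to every `n`. -/
theorem lie_lie_seq (n : ℤ) : ⁅⁅seq F 1, seq F 0⁆, seq F n⁆ =
    (2 : F) • seq F (n + 1) - (2 : F) • seq F (n - 1) := by
  have h : ∀ n, shift F ⁅⁅B F, A F⁆, seq F n⁆ = ⁅⁅B F, A F⁆, seq F (n + 1)⁆ := by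
    intro n; rw [shift_lie, shift_lie_B_A, shift_seq]
  have h' : ∀ n, shift F ((2 : F) • seq F (n + 1) - (2 : F) • seq F (n - 1)) =
      (2 : F) • seq F (n + 1 + 1) - (2 : F) • seq F (n + 1 - 1) := by
    intro n; rw [map_sub, map_smul, map_smul, shift_seq, shift_seq]; congr 3; ring
  rw [seq_zero, seq_one]
  induction n with
  | zero =>
    rw [zero_add, zero_sub, seq_zero, seq_one, seq_neg_one, ← lie_skew, ← lie_skew (B F), lie_neg]
    module
  | succ i ih => rw [← h, ih, h']
  | pred i ih =>
    apply (shift F).injective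
    rw [h, h', sub_add_cancel, ih]

/-- The elements `G_n = [A_n, A_0]`. -/
def lieSeq (F : Type*) [Field F] [CharZero F] (n : ℤ) : Onsager F := ⁅seq F n, seq F 0⁆

theorem lieSeq_zero : lieSeq F 0 = 0 := lie_self _

theorem lie_seq_of_le {l m : ℤ} (h : m ≤ l) : ⁅seq F l, seq F m⁆ = lieSeq F (l - m) := by
  obtain ⟨k, rfl⟩ := Int.le.dest h
  rw [(onsager_relations lie_lie_seq lie_seq_succ k).1, lieSeq, add_sub_cancel_left]

theorem lieSeq_neg (n : ℕ) : lieSeq F (-n) = -lieSeq F n := by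
  rw [lieSeq, ← lie_skew, lie_seq_of_le (by simp)]; simp

theorem lie_seq (l m : ℤ) : ⁅seq F l, seq F m⁆ = lieSeq F (l - m) := by
  rcases le_total m l with h | h
  · exact lie_seq_of_le h
  · rw [← lie_skew, lie_seq_of_le h, ← neg_sub m l]
    obtain ⟨k, hk⟩ := Int.le.dest h
    rw [← hk, add_sub_cancel_left, lieSeq_neg]

theorem lie_lieSeq (k : ℕ) (n : ℤ) : ⁅lieSeq F k, seq F n⁆ =
    (2 : F) • seq F (n + k) - (2 : F) • seq F (n - k) :=
  (onsager_relations lie_lie_seq lie_seq_succ k).2 n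

/-! ### The filtration of the Onsager algebra by finite-dimensional subspaces -/

/-- The span of `A_n` for `-N ≤ n ≤ N + 1` and `G_n` for `1 ≤ n ≤ N + 1`. -/
def filt (F : Type*) [Field F] [CharZero F] (N : ℕ) : Submodule F (Onsager F) := by
  classical
  exact Submodule.span F (((Finset.Icc (-N : ℤ) (N + 1)).image (seq F) ∪
    (Finset.Icc (1 : ℤ) (N + 1)).image (lieSeq F) : Finset (Onsager F)) : Set (Onsager F))

theorem finite_filt (N : ℕ) : Module.Finite F (filt F N) := by
  unfold filt; infer_instance

/-- There are `2N + 2` elements `A_n` and `N + 1` elements `G_n`. -/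
theorem finrank_filt_le (N : ℕ) : Module.finrank F (filt F N) ≤ 3 * (N + 1) := by
  classical
  refine (finrank_span_finset_le_card _).trans ((Finset.card_union_le _ _).trans ?_)
  refine (Nat.add_le_add Finset.card_image_le Finset.card_image_le).trans ?_
  simp only [Int.card_Icc]
  omega

theorem seq_mem_filt {N : ℕ} {n : ℤ} (h : -N ≤ n) (h' : n ≤ N + 1) : seq F n ∈ filt F N := by
  classical
  refine Submodule.subset_span ?_
  simp only [Finset.coe_union, Finset.coe_image, Finset.coe_Icc]
  exact Or.inl ⟨n, ⟨h, h'⟩, rfl⟩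

theorem lieSeq_mem_filt {N : ℕ} {n : ℤ} (h : 0 ≤ n) (h' : n ≤ N + 1) : lieSeq F n ∈ filt F N := by
  classical
  rcases h.eq_or_lt with rfl | h
  · rw [lieSeq_zero]; exact Submodule.zero_mem _
  refine Submodule.subset_span ?_
  simp only [Finset.coe_union, Finset.coe_image, Finset.coe_Icc]
  exact Or.inr ⟨n, ⟨h, h'⟩, rfl⟩

theorem filt_induction {N : ℕ} {M : Submodule F (Onsager F)}
    (hA : ∀ n : ℤ, -N ≤ n → n ≤ N + 1 → seq F n ∈ M)
    (hG : ∀ n : ℕ, 1 ≤ n → n ≤ N + 1 → lieSeq F n ∈ M) : filt F N ≤ M := by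
  classical
  refine Submodule.span_le.2 ?_
  simp only [Finset.coe_union, Finset.coe_image, Finset.coe_Icc]
  rintro _ (⟨n, ⟨h1, h2⟩, rfl⟩ | ⟨n, ⟨h1, h2⟩, rfl⟩)
  · exact hA n h1 h2
  · obtain ⟨m, rfl⟩ := Int.eq_ofNat_of_zero_le (by omega : 0 ≤ n)
    exact hG m (by omega) (by omega)

theorem filt_mono : Monotone (filt F) := fun _ _ h =>
  filt_induction (fun _ h1 h2 => seq_mem_filt (by omega) (by omega))
    fun _ h1 h2 => lieSeq_mem_filt (by omega) (by omega)

theorem seq_mem_iSup_filt (n : ℤ) : seq F n ∈ ⨆ N, filt F N :=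
  (le_iSup (filt F) n.natAbs) (seq_mem_filt (by omega) (by omega))

theorem lieSeq_mem_iSup_filt (n : ℤ) : lieSeq F n ∈ ⨆ N, filt F N := by
  have h : ∀ k : ℕ, lieSeq F k ∈ ⨆ N, filt F N := fun k =>
    (le_iSup (filt F) k) (lieSeq_mem_filt (by omega) (by omega))
  obtain ⟨k, rfl | rfl⟩ := n.eq_nat_or_neg
  · exact h k
  · rw [lieSeq_neg]; exact Submodule.neg_mem _ (h k)

/-- `O` is the union of the `filt F N`. -/
theorem exists_mem_filt (u : Onsager F) : ∃ N, u ∈ filt F N := by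
  rw [← Submodule.mem_iSup_of_directed _ filt_mono.directed_le]
  have key : ∀ l : ℤ, ∀ m ∈ ⨆ N, filt F N, ⁅seq F l, m⁆ ∈ ⨆ N, filt F N := by
    intro l
    have : (⨆ N, filt F N) ≤ (⨆ N, filt F N).comap (LieAlgebra.ad F (Onsager F) (seq F l)) := by
      refine iSup_le fun N => filt_induction (fun n _ _ => ?_) fun n _ _ => ?_
      · rw [Submodule.mem_comap, LieAlgebra.ad_apply, lie_seq]
        exact lieSeq_mem_iSup_filt _
      · rw [Submodule.mem_comap, LieAlgebra.ad_apply, ← lie_skew, lie_lieSeq]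
        exact Submodule.neg_mem _ (Submodule.sub_mem _
          (Submodule.smul_mem _ _ (seq_mem_iSup_filt _))
          (Submodule.smul_mem _ _ (seq_mem_iSup_filt _)))
    exact fun m hm => this hm
  refine mem_of_lie_mem _ ?_ ?_ ?_ ?_ u
  · rw [← seq_zero]; exact seq_mem_iSup_filt 0
  · rw [← seq_one]; exact seq_mem_iSup_filt 1
  · rw [← seq_zero]; exact key 0
  · rw [← seq_one]; exact key 1

end Onsager

/-! ### Coordinates and the action of `𝒜` on the loop algebra -/

namespace LaurentAlg

variable (F : Type*) [Field F]

theorem algebraMap_injective :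
    Function.Injective (algebraMap (Polynomial F) (LaurentAlg F)) :=
  IsLocalization.injective (LaurentAlg F) (M := Submonoid.powers _)
    (powers_le_nonZeroDivisors_of_noZeroDivisors
      (mul_ne_zero Polynomial.X_ne_zero
        (by simpa using Polynomial.X_sub_C_ne_zero (1 : F))))

end LaurentAlg

namespace SL2

variable (F : Type*) [Field F]

/-- The matrix entries of an element of `sl₂`. -/
def entry (i j : Fin 2) : SL2 F →ₗ[F] F where
  toFun m := m.1 i j
  map_add' _ _ := rfl
  map_smul' _ _ := rfl

theorem entry_apply (i j : Fin 2) (m : SL2 F) : entry F i j m = m.1 i j := rfl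

/-- The coordinates in the equitable basis. -/
def coord : Fin 3 → SL2 F →ₗ[F] F
  | 0 => (2⁻¹ : F) • entry F 0 1
  | 1 => -((2⁻¹ : F) • entry F 1 0)
  | 2 => entry F 0 0 + (2⁻¹ : F) • entry F 0 1 - (2⁻¹ : F) • entry F 1 0

variable {F} in
theorem eq_coord [CharZero F] (m : SL2 F) :
    m = coord F 0 m • x F + coord F 1 m • y F + coord F 2 m • z F := by
  have hm : m.1 0 0 + m.1 1 1 = 0 := by
    have : Matrix.trace m.1 = 0 := LinearMap.mem_ker.1 m.2
    simpa [Matrix.trace, Fin.sum_univ_two] using this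
  apply Subtype.ext
  ext i j
  fin_cases i <;> fin_cases j <;> simp [coord, entry_apply, x, y, z, e, f, h] <;>
    first | ring1 | linear_combination hm

theorem coord_x [CharZero F] (i : Fin 3) : coord F i (x F) = ![1, 0, 0] i := by
  fin_cases i <;> simp [coord, entry_apply, x, e, h]

theorem coord_y [CharZero F] (i : Fin 3) : coord F i (y F) = ![0, 1, 0] i := by
  fin_cases i <;> simp [coord, entry_apply, y, f, h]

theorem coord_z (i : Fin 3) : coord F i (z F) = ![0, 0, 1] i := by
  fin_cases i <;> simp [coord, entry_apply, z, h]

end SL2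

namespace Loop

open LaurentAlg

variable {F : Type*} [Field F]

theorem lie_genImage_cube (i j : Fin 4) (hij : i ≠ j)
    (p : LaurentAlg F × LaurentAlg F × LaurentAlg F) :
    ⁅genImage F i j, ⁅genImage F i j, ⁅genImage F i j, ofCoord p⁆⁆⁆ =
      (4 : F) • ⁅genImage F i j, ofCoord p⁆ := by
  rw [genImage_eq, lie_ofCoord, lie_ofCoord, lie_ofCoord, genCoord_dolanGrady _ _ _ i j hij]
  simp only [ofCoord, four_smul_elt]
  rfl

variable (F) in
/-- The equitable coordinates on `L(sl₂)⁺`. -/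
def coord (i : Fin 3) : Loop F →ₗ[F] LaurentAlg F :=
  (TensorProduct.rid F (LaurentAlg F)).toLinearMap ∘ₗ (SL2.coord F i).lTensor (LaurentAlg F)

theorem coord_tens (i : Fin 3) (u : SL2 F) (a : LaurentAlg F) :
    coord F i (tens u a) = SL2.coord F i u • a := rfl

theorem coord_elt [CharZero F] (i : Fin 3) (a b c : LaurentAlg F) :
    coord F i (elt a b c) = ![a, b, c] i := by
  rw [elt, map_add, map_add, coord_tens, coord_tens, coord_tens, SL2.coord_x, SL2.coord_y,
    SL2.coord_z]
  fin_cases i <;> simp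

theorem smul_tens (r : F) (u : SL2 F) (a : LaurentAlg F) : r • tens u a = tens u (r • a) :=
  TensorProduct.smul_tmul' r a u

theorem tens_smul (r : F) (u : SL2 F) (a : LaurentAlg F) : tens (r • u) a = tens u (r • a) :=
  (TensorProduct.smul_tmul r a u).symm

@[elab_as_elim]
theorem induction_on {P : Loop F → Prop} (u : Loop F) (zero : P 0) (tens : ∀ u a, P (tens u a))
    (add : ∀ u v, P u → P v → P (u + v)) : P u :=
  TensorProduct.induction_on (motive := P) u zero (fun a u => tens u a) add

theorem exists_ofCoord [CharZero F] (u : Loop F) : ∃ p, u = ofCoord p := by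
  induction u using induction_on with
  | zero => exact ⟨(0, 0, 0), elt_zero.symm⟩
  | tens u a =>
    refine ⟨(SL2.coord F 0 u • a, SL2.coord F 1 u • a, SL2.coord F 2 u • a), ?_⟩
    conv_lhs => rw [SL2.eq_coord u]
    rw [ofCoord, elt, add_tens, add_tens, tens_smul, tens_smul, tens_smul]
  | add u v hu hv =>
    obtain ⟨p, rfl⟩ := hu
    obtain ⟨q, rfl⟩ := hv
    exact ⟨p + q, elt_add _ _ _ _ _ _⟩

/-- The generators of `⊠` act on `L(sl₂)⁺` with `ad³ = 4 ad`. -/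
theorem lie_genImage_lie_lie [CharZero F] (i j : Fin 4) (hij : i ≠ j) (u : Loop F) :
    ⁅genImage F i j, ⁅genImage F i j, ⁅genImage F i j, u⁆⁆⁆ = (4 : F) • ⁅genImage F i j, u⁆ := by
  obtain ⟨p, rfl⟩ := exists_ofCoord u
  exact lie_genImage_cube i j hij p

/-- Multiplication by an element of `𝒜`. -/
def mulA (a : LaurentAlg F) : Loop F →ₗ[F] Loop F :=
  (LinearMap.mulLeft F a).rTensor (SL2 F)

theorem mulA_tens (a b : LaurentAlg F) (u : SL2 F) : mulA a (tens u b) = tens u (a * b) := rfl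

theorem mulA_elt (a b c d : LaurentAlg F) :
    mulA a (elt b c d) = elt (a * b) (a * c) (a * d) := by
  simp only [elt, map_add, mulA_tens]

theorem mulA_mulA (a b : LaurentAlg F) (u : Loop F) : mulA a (mulA b u) = mulA (a * b) u := by
  induction u using induction_on with
  | zero => simp
  | tens u c => rw [mulA_tens, mulA_tens, mulA_tens, mul_assoc]
  | add u v hu hv => simp only [map_add, hu, hv]

theorem mulA_one (u : Loop F) : mulA 1 u = u := by
  induction u using induction_on with
  | zero => simp
  | tens u c => rw [mulA_tens, one_mul]
  | add u v hu hv => simp only [map_add, hu, hv]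

theorem mulA_add (a b : LaurentAlg F) (u : Loop F) : mulA (a + b) u = mulA a u + mulA b u := by
  induction u using induction_on with
  | zero => simp
  | tens u c => rw [mulA_tens, mulA_tens, mulA_tens, add_mul, tens_add]
  | add u v hu hv => simp only [map_add, hu, hv]; abel

theorem mulA_smul (r : F) (a : LaurentAlg F) (u : Loop F) : mulA (r • a) u = r • mulA a u := by
  induction u using induction_on with
  | zero => simp
  | tens u c => rw [mulA_tens, mulA_tens, smul_tens, smul_mul_assoc]
  | add u v hu hv => simp only [map_add, hu, hv, smul_add]

theorem mulA_lie (a : LaurentAlg F) (u v : Loop F) : mulA a ⁅u, v⁆ = ⁅mulA a u, v⁆ := by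
  induction u using induction_on with
  | zero => simp
  | tens u b =>
    induction v using induction_on with
    | zero => simp
    | tens v c => rw [lie_tens, mulA_tens, mulA_tens, lie_tens, mul_assoc]
    | add u v hu hv => simp only [lie_add, map_add, hu, hv]
  | add u v hu hv => simp only [add_lie, map_add, hu, hv]

theorem lie_mulA (a : LaurentAlg F) (u v : Loop F) : mulA a ⁅u, v⁆ = ⁅u, mulA a v⁆ := by
  rw [← lie_skew, map_neg, mulA_lie, lie_skew]

theorem smul_elt (r : F) (a b c : LaurentAlg F) :
    r • elt a b c = elt (r • a) (r • b) (r • c) := by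
  simp only [elt, smul_add, smul_tens]

theorem neg_elt (a b c : LaurentAlg F) : -elt a b c = elt (-a) (-b) (-c) := by
  simp only [elt, tens_neg]; abel

theorem A_eq (i : ℕ) : A F i = elt (-(-t F) ^ i) 0 0 := by
  simp [A, elt, tens_zero, tens_neg]

theorem B_eq (i : ℕ) : B F i = elt 0 (t F * (-t F) ^ i) ((t F - 1) * (-t F) ^ i) := by
  simp [B, elt, tens_zero]

theorem psi_eq (i : ℕ) : psi F i = elt 0 (-(-t F) ^ i) 0 := by
  simp [psi, elt, tens_zero, tens_neg]

theorem lie_A_A (i j : ℕ) : ⁅A F i, A F j⁆ = 0 := by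
  rw [A_eq, A_eq, lie_elt, ← elt_zero]; congr 1 <;> ring

theorem lie_B_B (i j : ℕ) : ⁅B F i, B F j⁆ = 0 := by
  rw [B_eq, B_eq, lie_elt, ← elt_zero]; congr 1 <;> ring

theorem lie_psi_psi (i j : ℕ) : ⁅psi F i, psi F j⁆ = 0 := by
  rw [psi_eq, psi_eq, lie_elt, ← elt_zero]; congr 1 <;> ring

theorem lie_psi_A (i j : ℕ) :
    ⁅psi F i, A F j⁆ = (2 : F) • psi F (i + j) + (2 : F) • A F (i + j) := by
  rw [psi_eq, psi_eq, A_eq, A_eq, lie_elt, two_smul_elt, two_smul_elt, elt_add]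
  congr 1 <;> ring

theorem lie_B_psi (i j : ℕ) :
    ⁅B F i, psi F j⁆ = (2 : F) • B F (i + j) + (2 : F) • psi F (i + j) := by
  rw [psi_eq, psi_eq, B_eq, B_eq, lie_elt, two_smul_elt, two_smul_elt, elt_add]
  congr 1 <;> ring

theorem lie_A_B (i j : ℕ) : ⁅A F i, B F j⁆ =
    (2 : F) • A F (i + j) + (2 : F) • B F (i + j) - (4 : F) • psi F (i + j + 1) := by
  rw [psi_eq, B_eq, B_eq, A_eq, A_eq, lie_elt, two_smul_elt, two_smul_elt, four_smul_elt, elt_add,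
    elt_sub]
  congr 1 <;> ring

theorem mulA_family (i : ℕ) :
    mulA ((-t F) ^ i) (A F 0) = A F i ∧ mulA ((-t F) ^ i) (B F 0) = B F i ∧
      mulA ((-t F) ^ i) (psi F 1) = psi F (i + 1) := by
  simp only [A_eq, B_eq, psi_eq, mulA_elt]
  refine ⟨?_, ?_, ?_⟩ <;> congr 1 <;> ring

/-! ### Independence of the family, by polynomial coordinates -/

variable (F) in
/-- Polynomials, embedded in `𝒜` by `X ↦ -t`. -/
def polyEval : Polynomial F →ₐ[F] LaurentAlg F := Polynomial.aeval (-t F)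

theorem polyEval_eq (p : Polynomial F) :
    polyEval F p = algebraMap (Polynomial F) (LaurentAlg F) (p.comp (-Polynomial.X)) := by
  have : polyEval F = (Algebra.algHom F (Polynomial F) (LaurentAlg F)).comp
      (Polynomial.aeval (-Polynomial.X)) := by
    apply Polynomial.algHom_ext
    simp [polyEval, t]; rfl
  rw [this]; simp [Polynomial.comp, Polynomial.aeval_def, Polynomial.algebraMap_eq]; rfl

theorem polyEval_injective : Function.Injective (polyEval F) := by
  intro p q h
  rw [polyEval_eq, polyEval_eq] at h
  have h2 := congrArg (Polynomial.comp · (-Polynomial.X)) (algebraMap_injective F h)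
  simpa [Polynomial.comp_assoc] using h2

theorem polyEval_X : polyEval F Polynomial.X = -t F := by simp [polyEval]

variable (F) in
/-- The parametrization of the span of `A_i, B_i, ψ_{i+1}` by triples of polynomials. -/
def polyElt : Polynomial F × Polynomial F × Polynomial F →ₗ[F] Loop F where
  toFun p := elt (-polyEval F p.1) (t F * polyEval F p.2.1 + t F * polyEval F p.2.2)
    ((t F - 1) * polyEval F p.2.1)
  map_add' p q := by
    rw [elt_add]; simp only [Prod.fst_add, Prod.snd_add, map_add]; congr 1 <;> ring
  map_smul' r p := by
    rw [RingHom.id_apply, smul_elt]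
    simp only [Prod.smul_fst, Prod.smul_snd, map_smul]
    simp only [Algebra.smul_def]; congr 1 <;> ring

theorem polyElt_apply (p : Polynomial F × Polynomial F × Polynomial F) : polyElt F p =
    elt (-polyEval F p.1) (t F * polyEval F p.2.1 + t F * polyEval F p.2.2)
      ((t F - 1) * polyEval F p.2.1) := rfl

/-- The equitable coordinates can be solved for the three polynomials because `t` and `t - 1` are
invertible in `𝒜`. -/
theorem polyElt_injective [CharZero F] : Function.Injective (polyElt F) := by
  rw [injective_iff_map_eq_zero]
  intro p hp
  have h (i : Fin 3) := congrArg (coord F i) hp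
  simp only [polyElt_apply, coord_elt, map_zero] at h
  have h0 := h 0
  have h1 := h 1
  have h2 := h 2
  simp only [Matrix.cons_val, neg_eq_zero] at h0 h1 h2
  have e1 : polyEval F p.2.1 = 0 := by
    linear_combination tSubOneInv F * h2 - polyEval F p.2.1 * tSubOne_mul_tSubOneInv F
  have e2 : polyEval F p.2.2 = 0 := by
    linear_combination tInv F * h1 - (polyEval F p.2.1 + polyEval F p.2.2) * t_mul_tInv F - e1
  have inj {q : Polynomial F} (hq : polyEval F q = 0) : q = 0 :=
    polyEval_injective (hq.trans (map_zero _).symm)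
  exact Prod.ext (inj h0) (Prod.ext (inj e1) (inj e2))

variable (F) in
/-- The monomial basis of triples of polynomials. -/
def polyBasis : Module.Basis (ℕ ⊕ ℕ ⊕ ℕ) F (Polynomial F × Polynomial F × Polynomial F) :=
  (Polynomial.basisMonomials F).prod ((Polynomial.basisMonomials F).prod
    (Polynomial.basisMonomials F))

theorem polyElt_polyBasis (s : ℕ ⊕ ℕ ⊕ ℕ) : polyElt F (polyBasis F s) = family F s := by
  have hX (i : ℕ) : polyEval F (Polynomial.monomial i 1) = (-t F) ^ i := by
    rw [← Polynomial.X_pow_eq_monomial, map_pow, polyEval_X]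
  rcases s with i | i | i <;>
    simp [polyElt_apply, polyBasis, Module.Basis.prod_apply, family, A_eq, B_eq, psi_eq, hX]
  congr 1; ring

theorem linearIndependent_family [CharZero F] : LinearIndependent F (family F) := by
  have := (polyBasis F).linearIndependent.map' (polyElt F)
    (LinearMap.ker_eq_bot.2 polyElt_injective)
  rwa [show polyElt F ∘ polyBasis F = family F from funext polyElt_polyBasis] at this

theorem span_family : Submodule.span F (Set.range (family F)) = LinearMap.range (polyElt F) := by
  have : family F = polyElt F ∘ polyBasis F := funext fun s => (polyElt_polyBasis s).symm
  rw [this, Set.range_comp, Submodule.span_image, (polyBasis F).span_eq, Submodule.map_top]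

end Loop

/-! ### The dimension count -/

/-- If a space spanned by at most `m` vectors has image containing `m` linearly independent
vectors, the map is injective on it and those vectors span its image. -/
theorem injOn_of_linearIndependent {F E L ι : Type*} [Field F] [AddCommGroup E] [Module F E]
    [AddCommGroup L] [Module F L] [Fintype ι] (S : Submodule F E) [Module.Finite F S]
    (hS : Module.finrank F S ≤ Fintype.card ι) (φ : E →ₗ[F] L) (w : ι → L)
    (hw : LinearIndependent F w) (h : ∀ i, w i ∈ S.map φ) :
    (∀ u ∈ S, φ u = 0 → u = 0) ∧ S.map φ = Submodule.span F (Set.range w) := by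
  have hle : Submodule.span F (Set.range w) ≤ S.map φ :=
    Submodule.span_le.2 (Set.range_subset_iff.2 h)
  have hcard := finrank_span_eq_card hw
  have hmap : Module.finrank F (S.map φ) ≤ Module.finrank F S := Submodule.finrank_map_le φ S
  refine ⟨?_, (Submodule.eq_of_le_of_finrank_le hle (by omega)).symm⟩
  have hrank := Submodule.finrank_mono hle
  have hr : LinearMap.range (φ.domRestrict S) = S.map φ := by
    rw [LinearMap.range_domRestrict]
  have hker := (φ.domRestrict S).finrank_range_add_finrank_ker
  rw [hr] at hker
  have : Module.finrank F (LinearMap.ker (φ.domRestrict S)) = 0 := by omega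
  have hbot := Submodule.finrank_eq_zero.1 this
  intro u hu hφ
  have hmem : (⟨u, hu⟩ : S) ∈ LinearMap.ker (φ.domRestrict S) := hφ
  rw [hbot, Submodule.mem_bot] at hmem
  exact congrArg Subtype.val hmem

namespace Loop

open LaurentAlg Onsager

variable {F : Type*} [Field F]

theorem ofOnsager_A : ofOnsager F (Onsager.A F) = genImage F 1 2 := by
  have : Tet.ofOnsager F (Onsager.A F) = Tet.x F 1 2 := Presented.lift_of _ _ _ _
  rw [ofOnsager, LieHom.comp_apply, this, sigma_x]

theorem ofOnsager_B : ofOnsager F (Onsager.B F) = genImage F 0 3 := by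
  have : Tet.ofOnsager F (Onsager.B F) = Tet.x F 0 3 := Presented.lift_of _ _ _ _
  rw [ofOnsager, LieHom.comp_apply, this, sigma_x]

theorem ofOnsager_A_eq : ofOnsager F (Onsager.A F) = elt 1 0 0 := by
  rw [ofOnsager_A, genImage_eq]; rfl

theorem ofOnsager_B_eq : ofOnsager F (Onsager.B F) = elt 0 (t F) (t F - 1) := by
  rw [ofOnsager_B, genImage_eq]; rfl

theorem A_zero : A F 0 = -ofOnsager F (Onsager.A F) := by
  rw [A_eq, ofOnsager_A_eq, neg_elt]; simp

theorem B_zero : B F 0 = ofOnsager F (Onsager.B F) := by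
  rw [B_eq, ofOnsager_B_eq]; simp

variable [CharZero F]

/-- On the Onsager sequence, `2 - 4t` acts as the sum of the two neighbours. -/
theorem mulA_seq (n : ℤ) : mulA (2 - 4 * t F) (ofOnsager F (seq F n)) =
    ofOnsager F (seq F (n + 1)) + ofOnsager F (seq F (n - 1)) := by
  set φ := ofOnsager F with hφ
  set c := 2 - 4 * t F with hc
  have hg (n : ℤ) : (2 : F) • φ (seq F (n + 1)) =
      ⁅⁅φ (seq F 1), φ (seq F 0)⁆, φ (seq F n)⁆ + (2 : F) • φ (seq F (n - 1)) := by
    rw [← LieHom.map_lie, ← LieHom.map_lie, lie_lie_seq, map_sub, map_smul, map_smul,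
      sub_add_cancel]
  -- `D n` is the defect of the claimed identity. Multiplication by `c` commutes with `ad [A_1,
  -- A_0]`, so the three-term recursion `hg` makes `D (n+1) = D (n-1)` whenever `D n = 0`. Vanishing
  -- at two consecutive indices thus spreads in both directions, and only `n = 0, 1` need
  -- computation.
  let D (n : ℤ) := mulA c (φ (seq F n)) - φ (seq F (n + 1)) - φ (seq F (n - 1))
  have hD {n : ℤ} : D n = 0 ↔ mulA c (φ (seq F n)) = φ (seq F (n + 1)) + φ (seq F (n - 1)) := by
    rw [← sub_eq_zero (b := _ + _), ← sub_sub]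
  have step (n : ℤ) (h : D n = 0) : D (n + 1) = D (n - 1) := by
    rw [hD] at h
    have h1 := congrArg (mulA c) (hg n)
    rw [map_add, map_smul, map_smul, lie_mulA, h, lie_add] at h1
    have h2 := hg (n + 1)
    have h3 := hg (n - 1)
    rw [add_sub_cancel_right] at h2
    rw [sub_add_cancel] at h3
    refine smul_right_injective _ (two_ne_zero : (2 : F) ≠ 0) ?_
    simp only [D, smul_sub, h1, h2, sub_add_cancel, add_sub_cancel_right]
    rw [h3]
    abel
  have key (n : ℤ) : D n = 0 ∧ D (n + 1) = 0 := by
    induction n with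
    | zero =>
      refine ⟨hD.2 ?_, hD.2 ?_⟩
      · have hq : ⁅elt (1 : LaurentAlg F) 0 0, ⁅elt (1 : LaurentAlg F) 0 0,
            elt 0 (t F) (t F - 1)⁆⁆ =
            (2 : F) • elt (4 * t F - 2) (2 * t F) (2 * t F - 2) := by
          rw [two_smul_elt, lie_elt, lie_elt]; congr 1 <;> ring
        rw [zero_add, zero_sub, seq_zero, seq_one, seq_neg_one, map_sub, map_smul, LieHom.map_lie,
          LieHom.map_lie, hφ, ofOnsager_A_eq, ofOnsager_B_eq, hq, inv_smul_smul₀ two_ne_zero,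
          mulA_elt, elt_sub, elt_add]
        congr 1 <;> ring
      · have h1 := hg 1
        rw [sub_self, seq_zero, seq_one, hφ, ofOnsager_A_eq, ofOnsager_B_eq] at h1
        refine smul_right_injective _ (two_ne_zero : (2 : F) ≠ 0) ?_
        simp only [zero_add, sub_self, smul_add]
        rw [hφ, h1, seq_zero, seq_one, ofOnsager_A_eq, ofOnsager_B_eq, mulA_elt, lie_elt, lie_elt,
          two_smul_elt, two_smul_elt, elt_add, elt_add]
        congr 1 <;> ring
    | succ i ih =>
      refine ⟨ih.2, ?_⟩
      rw [step _ ih.2, add_sub_cancel_right, ih.1]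
    | pred i ih =>
      rw [sub_add_cancel]
      exact ⟨by rw [← step _ ih.1, ih.2], ih.1⟩
  exact hD.1 (key n).1

theorem mulA_lieSeq (n : ℤ) : mulA (2 - 4 * t F) (ofOnsager F (lieSeq F n)) =
    ofOnsager F (lieSeq F (n + 1)) + ofOnsager F (lieSeq F (n - 1)) := by
  simp only [lieSeq, LieHom.map_lie]
  rw [mulA_lie, mulA_seq, add_lie]

/-- Passing to neighbours widens each index window by one step; for `G_1` the lower neighbour is
`G_0 = 0`. -/
theorem map_mulA_filt (N : ℕ) (u : Loop F) (hu : u ∈ (filt F N).map (ofOnsager F : _ →ₗ[F] Loop F)) :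
    mulA (-t F) u ∈ (filt F (N + 1)).map (ofOnsager F : _ →ₗ[F] Loop F) := by
  have hc : -t F = (4⁻¹ : F) • (2 - 4 * t F) + (-(2⁻¹) : F) • 1 := by
    have h4 : (4 : LaurentAlg F) = algebraMap F _ 4 := (map_ofNat _ 4).symm
    have h2 : (2 : LaurentAlg F) = algebraMap F _ 2 := (map_ofNat _ 2).symm
    have e4 : algebraMap F (LaurentAlg F) 4⁻¹ * 4 = 1 := by
      rw [h4, ← map_mul, inv_mul_cancel₀ (by norm_num : (4 : F) ≠ 0), map_one]
    have e2 : algebraMap F (LaurentAlg F) 4⁻¹ * 2 = algebraMap F (LaurentAlg F) 2⁻¹ := by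
      rw [h2, ← map_mul]; congr 1; norm_num
    simp only [Algebra.smul_def, mul_one, map_neg]
    linear_combination -e2 + t F * e4
  have key : filt F N ≤ ((filt F (N + 1)).map (ofOnsager F : _ →ₗ[F] Loop F)).comap
      (mulA (2 - 4 * t F) ∘ₗ (ofOnsager F : _ →ₗ[F] Loop F)) := by
    refine filt_induction (fun n h1 h2 => ?_) fun n h1 h2 => ?_
    · rw [Submodule.mem_comap, LinearMap.comp_apply]
      erw [mulA_seq]
      exact Submodule.add_mem _
        (Submodule.mem_map_of_mem (seq_mem_filt (by push_cast; omega) (by push_cast; omega)))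
        (Submodule.mem_map_of_mem (seq_mem_filt (by push_cast; omega) (by push_cast; omega)))
    · rw [Submodule.mem_comap, LinearMap.comp_apply]
      erw [mulA_lieSeq]
      exact Submodule.add_mem _
        (Submodule.mem_map_of_mem (lieSeq_mem_filt (by omega) (by push_cast; omega)))
        (Submodule.mem_map_of_mem (lieSeq_mem_filt (by omega) (by push_cast; omega)))
  obtain ⟨v, hv, rfl⟩ := hu
  rw [hc, mulA_add, mulA_smul, mulA_smul, mulA_one]
  exact Submodule.add_mem _ (Submodule.smul_mem _ _ (key hv))
    (Submodule.smul_mem _ _ (Submodule.mem_map_of_mem (filt_mono N.le_succ hv)))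

theorem mulA_pow_mem (i : ℕ) (u : Loop F)
    (hu : u ∈ (filt F 0).map (ofOnsager F : _ →ₗ[F] Loop F)) :
    mulA ((-t F) ^ i) u ∈ (filt F i).map (ofOnsager F : _ →ₗ[F] Loop F) := by
  induction i with
  | zero => rwa [pow_zero, mulA_one]
  | succ i ih => rw [pow_succ', ← mulA_mulA]; exact map_mulA_filt i _ ih

theorem A_mem (i : ℕ) : A F i ∈ (filt F i).map (ofOnsager F : _ →ₗ[F] Loop F) := by
  rw [← (mulA_family i).1]
  refine mulA_pow_mem i _ ?_
  rw [A_zero, ← seq_zero]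
  exact Submodule.neg_mem _ (Submodule.mem_map_of_mem (seq_mem_filt (by simp) (by simp)))

theorem B_mem (i : ℕ) : B F i ∈ (filt F i).map (ofOnsager F : _ →ₗ[F] Loop F) := by
  rw [← (mulA_family i).2.1]
  refine mulA_pow_mem i _ ?_
  rw [B_zero, ← seq_one]
  exact Submodule.mem_map_of_mem (seq_mem_filt (by simp) (by simp))

theorem psi_mem (i : ℕ) : psi F (i + 1) ∈ (filt F i).map (ofOnsager F : _ →ₗ[F] Loop F) := by
  rw [← (mulA_family i).2.2]
  refine mulA_pow_mem i _ ?_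
  -- The bracket formula for `[A_0, B_0]`, solved for `ψ_1`.
  have h : psi F 1 = (4⁻¹ : F) • ((2 : F) • A F 0 + (2 : F) • B F 0 - ⁅A F 0, B F 0⁆) := by
    rw [lie_A_B, sub_sub_cancel, smul_smul, inv_mul_cancel₀ (by norm_num : (4 : F) ≠ 0), one_smul]
  have hG : ⁅A F 0, B F 0⁆ = ofOnsager F (lieSeq F 1) := by
    rw [lieSeq, LieHom.map_lie, seq_zero, seq_one, A_zero, B_zero, neg_lie, lie_skew]
  rw [h, hG]
  exact Submodule.smul_mem _ _ (Submodule.sub_mem _ (Submodule.add_mem _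
    (Submodule.smul_mem _ _ (A_mem 0)) (Submodule.smul_mem _ _ (B_mem 0)))
    (Submodule.mem_map_of_mem (lieSeq_mem_filt (by simp) (by simp))))

/-- `O → L(sl₂)⁺` is injective on `filt F N`, with image in the span of the family. -/
theorem filt_spec (N : ℕ) : (∀ u ∈ filt F N, ofOnsager F u = 0 → u = 0) ∧
    (filt F N).map (ofOnsager F : _ →ₗ[F] Loop F) ≤ Submodule.span F (Set.range (family F)) := by
  let ι := Fin (N + 1) ⊕ Fin (N + 1) ⊕ Fin (N + 1)
  let e : ι → ℕ ⊕ ℕ ⊕ ℕ := Sum.map (↑) (Sum.map (↑) (↑))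
  have he : Function.Injective e :=
    Sum.map_injective.2 ⟨Fin.val_injective, Sum.map_injective.2 ⟨Fin.val_injective, Fin.val_injective⟩⟩
  have := finite_filt (F := F) N
  -- The `3(N+1)` family members of index at most `N` match the bound on the dimension of `filt F
  -- N`.
  have h := injOn_of_linearIndependent (filt F N)
    ((finrank_filt_le N).trans (by simp [ι]; omega)) (ofOnsager F : _ →ₗ[F] Loop F) (family F ∘ e)
    (linearIndependent_family.comp e he) (by
      have hm (i : Fin (N + 1)) := Submodule.map_mono (f := (ofOnsager F : _ →ₗ[F] Loop F))
        (filt_mono (F := F) (show (i : ℕ) ≤ N by omega))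
      rintro (i | i | i)
      · exact hm i (A_mem _)
      · exact hm i (B_mem _)
      · exact hm i (psi_mem _))
  exact ⟨h.1, h.2.trans_le (Submodule.span_mono (Set.range_comp_subset_range _ _))⟩

theorem ofOnsager_injective : Function.Injective (ofOnsager F) := by
  rw [injective_iff_map_eq_zero]
  intro u hu
  obtain ⟨N, hN⟩ := exists_mem_filt u
  exact (filt_spec N).1 u hN hu

theorem range_ofOnsager : LinearMap.range (ofOnsager F : Onsager F →ₗ[F] Loop F) =
    Submodule.span F (Set.range (family F)) := by
  apply le_antisymm
  · rintro _ ⟨u, rfl⟩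
    obtain ⟨N, hN⟩ := exists_mem_filt u
    exact (filt_spec N).2 (Submodule.mem_map_of_mem hN)
  · rw [Submodule.span_le, Set.range_subset_iff]
    rintro (i | i | i)
    · exact LinearMap.map_le_range (A_mem i)
    · exact LinearMap.map_le_range (B_mem i)
    · exact LinearMap.map_le_range (psi_mem i)

variable (F) in
/-- The basis of `O` that corresponds to `A_i, B_i, ψ_{i+1}`. -/
def onsagerBasis : Module.Basis (ℕ ⊕ ℕ ⊕ ℕ) F (Onsager F) :=
  (Module.Basis.span linearIndependent_family).map
    ((LinearEquiv.ofInjective (ofOnsager F : Onsager F →ₗ[F] Loop F) ofOnsager_injective).trans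
      (LinearEquiv.ofEq _ _ range_ofOnsager)).symm

@[simp]
theorem ofOnsager_onsagerBasis (s : ℕ ⊕ ℕ ⊕ ℕ) : ofOnsager F (onsagerBasis F s) = family F s := by
  set e := (LinearEquiv.ofInjective (ofOnsager F : Onsager F →ₗ[F] Loop F)
    ofOnsager_injective).trans (LinearEquiv.ofEq _ _ range_ofOnsager) with he
  have h : e (onsagerBasis F s) = Module.Basis.span linearIndependent_family s := by
    rw [onsagerBasis, Module.Basis.map_apply, ← he, LinearEquiv.apply_symm_apply]
  have h2 := congrArg Subtype.val h
  rwa [Module.Basis.span_apply] at h2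

end Loop

/-! ### Likeness in the tetrahedron algebra -/

namespace Tet

section CommRing

variable {F : Type*} [CommRing F]

theorem x_swap (i j : Fin 4) (h : i ≠ j) : x F j i h.symm = -x F i j h := by
  have := Presented.mk_eq_zero (rels := {r | TetRel F r}) (TetRel.skew (F := F) i j h)
  rw [map_add] at this
  exact eq_neg_of_add_eq_zero_right this

theorem lie_x_x (i j k : Fin 4) (hij : i ≠ j) (hjk : j ≠ k) (hik : i ≠ k) :
    ⁅x F i j hij, x F j k hjk⁆ = (2 : F) • x F i j hij + (2 : F) • x F j k hjk := by
  have := Presented.mk_eq_zero (rels := {r | TetRel F r})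
    (TetRel.triangle (F := F) i j k hij hjk hik)
  simpa [freeX, x, Presented.of, sub_eq_zero] using this

theorem ofOnsager_A : ofOnsager F (Onsager.A F) = x F 1 2 := Presented.lift_of _ _ _ _

theorem ofOnsager_B : ofOnsager F (Onsager.B F) = x F 0 3 := Presented.lift_of _ _ _ _

variable (F) in
/-- The property `[ξ, [ξ, [ξ, η]]] = 4 [ξ, η]`. -/
def AdCube (ξ η : Tet F) : Prop := ⁅ξ, ⁅ξ, ⁅ξ, η⁆⁆⁆ = (4 : F) • ⁅ξ, η⁆

theorem AdCube.neg {ξ η : Tet F} (h : AdCube F ξ η) : AdCube F (-ξ) η := by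
  rw [AdCube] at h ⊢
  simp only [neg_lie, lie_neg, neg_neg, h, smul_neg]

theorem isLike_of {i j k h : Fin 4} (hij : i ≠ j) (hkh : k ≠ h)
    (hall : ∀ m : Fin 4, m ≠ i → m ≠ j → m = k ∨ m = h) {ξ : Tet F} (h0 : ⁅x F i j hij, ξ⁆ = 0)
    (h1 : AdCube F (x F k h hkh) ξ) : IsLike i j hij ξ := by
  refine ⟨h0, fun k' h' hkh' a b c d => ?_⟩
  rcases hall k' a b with rfl | rfl <;> rcases hall h' c d with rfl | rfl
  · exact absurd rfl hkh'
  · exact h1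
  · have := h1.neg
    rw [← x_swap] at this
    exact this
  · exact absurd rfl hkh'

/-- The span of the image of `O` and one further element. -/
def extend (ξ : Tet F) : Submodule F (Tet F) :=
  LinearMap.range (ofOnsager F : Onsager F →ₗ[F] Tet F) ⊔ Submodule.span F {ξ}

theorem mem_extend {ξ s : Tet F} : s ∈ extend ξ ↔ ∃ (o : Onsager F) (c : F), ofOnsager F o + c • ξ = s := by
  simp [extend, Submodule.mem_sup, Submodule.mem_span_singleton]

theorem ofOnsager_mem_extend (ξ : Tet F) (o : Onsager F) : ofOnsager F o ∈ extend ξ :=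
  mem_extend.2 ⟨o, 0, by simp⟩

theorem self_mem_extend (ξ : Tet F) : ξ ∈ extend ξ := mem_extend.2 ⟨0, 1, by simp⟩

/-- The extension is stable under `ad ξ` as soon as `ad ξ` maps `A` and `B` into it. -/
theorem lie_mem_extend {ξ : Tet F} (hA : ⁅ξ, x F 1 2⁆ ∈ extend ξ) (hB : ⁅ξ, x F 0 3⁆ ∈ extend ξ)
    {s : Tet F} (hs : s ∈ extend ξ) : ⁅ξ, s⁆ ∈ extend ξ := by
  -- A bracket `[o + c ξ, v]` needs only `[ξ, v]` to lie in the extension. By Leibniz, the `o` with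
  -- `[ξ, o]` in the extension therefore form a Lie subalgebra of `O`.
  have aux {w : Tet F} (hw : w ∈ extend ξ) {v : Onsager F}
      (hv : ⁅ξ, ofOnsager F v⁆ ∈ extend ξ) : ⁅w, ofOnsager F v⁆ ∈ extend ξ := by
    obtain ⟨o, c, rfl⟩ := mem_extend.1 hw
    rw [add_lie, ← LieHom.map_lie, smul_lie]
    exact Submodule.add_mem _ (ofOnsager_mem_extend _ _) (Submodule.smul_mem _ _ hv)
  let K : LieSubalgebra F (Onsager F) :=
    { carrier := {o | ⁅ξ, ofOnsager F o⁆ ∈ extend ξ}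
      add_mem' := fun {u v} hu hv => by
        rw [Set.mem_ofPred_eq, map_add, lie_add]; exact Submodule.add_mem _ hu hv
      zero_mem' := by
        rw [Set.mem_ofPred_eq, map_zero, lie_zero]; exact Submodule.zero_mem _
      smul_mem' := fun c u hu => by
        rw [Set.mem_ofPred_eq, map_smul, lie_smul]; exact Submodule.smul_mem _ c hu
      lie_mem' := fun {u v} hu hv => by
        rw [Set.mem_ofPred_eq, LieHom.map_lie, leibniz_lie, ← lie_skew (ofOnsager F u)]
        exact Submodule.add_mem _ (aux hu hv) (Submodule.neg_mem _ (aux hv hu)) }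
  obtain ⟨o, c, rfl⟩ := mem_extend.1 hs
  rw [lie_add, lie_smul, lie_self, smul_zero, add_zero]
  refine Onsager.mem_of_A_B_mem K ?_ ?_ o
  · change ⁅ξ, ofOnsager F (Onsager.A F)⁆ ∈ extend ξ
    rwa [ofOnsager_A]
  · change ⁅ξ, ofOnsager F (Onsager.B F)⁆ ∈ extend ξ
    rwa [ofOnsager_B]

theorem x_one_two_mem (ξ : Tet F) : x F 1 2 ∈ extend ξ := by
  rw [← ofOnsager_A]; exact ofOnsager_mem_extend _ _

theorem x_zero_three_mem (ξ : Tet F) : x F 0 3 ∈ extend ξ := by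
  rw [← ofOnsager_B]; exact ofOnsager_mem_extend _ _

/-- The pair `01` shares one index with each of `12` and `03`, so the triangle relations express
both brackets linearly. The same holds for `23` below. -/
theorem lie_x_zero_one_mem {s : Tet F} (hs : s ∈ extend (x F 0 1)) :
    ⁅x F 0 1, s⁆ ∈ extend (x F 0 1) := by
  refine lie_mem_extend ?_ ?_ hs
  · rw [lie_x_x 0 1 2 _ _ (by decide)]
    exact Submodule.add_mem _ (Submodule.smul_mem _ _ (self_mem_extend _))
      (Submodule.smul_mem _ _ (x_one_two_mem _))
  · rw [← lie_skew, ← neg_lie, ← x_swap 0 3 (by decide), lie_x_x 3 0 1 _ _ (by decide), x_swap 0 3 (by decide)]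
    exact Submodule.add_mem _ (Submodule.smul_mem _ _ (Submodule.neg_mem _ (x_zero_three_mem _)))
      (Submodule.smul_mem _ _ (self_mem_extend _))

theorem lie_x_two_three_mem {s : Tet F} (hs : s ∈ extend (x F 2 3)) :
    ⁅x F 2 3, s⁆ ∈ extend (x F 2 3) := by
  refine lie_mem_extend ?_ ?_ hs
  · rw [← lie_skew, lie_x_x 1 2 3 _ _ (by decide)]
    exact Submodule.neg_mem _ (Submodule.add_mem _ (Submodule.smul_mem _ _ (x_one_two_mem _))
      (Submodule.smul_mem _ _ (self_mem_extend _)))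
  · rw [x_swap 3 0 (by decide), lie_neg, lie_x_x 2 3 0 _ _ (by decide), x_swap 0 3 (by decide)]
    exact Submodule.neg_mem _ (Submodule.add_mem _ (Submodule.smul_mem _ _ (self_mem_extend _))
      (Submodule.smul_mem _ _ (Submodule.neg_mem _ (x_zero_three_mem _))))

end CommRing

variable {F : Type*} [Field F] [CharZero F]

open Loop LaurentAlg

theorem exists_polyElt (o : Onsager F) : ∃ p, Loop.ofOnsager F o = polyElt F p := by
  have h : Loop.ofOnsager F o ∈ LinearMap.range (Loop.ofOnsager F : Onsager F →ₗ[F] Loop F) :=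
    ⟨o, rfl⟩
  rw [range_ofOnsager, span_family] at h
  obtain ⟨p, hp⟩ := h
  exact ⟨p, hp.symm⟩

/-- `σ` is injective on the extension by `ξ` when `σ ξ` is not in the image of `O`. -/
theorem sigma_inj {ξ : Tet F}
    (hξ : ∀ p : Polynomial F × Polynomial F × Polynomial F, ∀ c : F,
      polyElt F p + c • sigma F ξ = 0 → c = 0)
    {s s' : Tet F} (hs : s ∈ extend ξ) (hs' : s' ∈ extend ξ) (h : sigma F s = sigma F s') :
    s = s' := by
  rw [← sub_eq_zero] at h ⊢
  rw [← map_sub] at h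
  obtain ⟨o, c, e⟩ := mem_extend.1 (Submodule.sub_mem _ hs hs')
  rw [← e] at h ⊢
  have ho : sigma F (Tet.ofOnsager F o) = Loop.ofOnsager F o := rfl
  obtain ⟨p, hp⟩ := exists_polyElt o
  rw [map_add, map_smul, ho] at h
  obtain rfl : c = 0 := hξ p c (by rw [← hp, h])
  rw [zero_smul, add_zero] at h
  rw [ofOnsager_injective (h.trans (map_zero _).symm), map_zero, zero_smul, add_zero]

/-- A polynomial in `t` that is divisible by `t` has no constant term. -/
theorem eq_zero_of_polyEval {F : Type*} [Field F] {p : Polynomial F} {c : F}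
    (h : t F * polyEval F p + algebraMap F (LaurentAlg F) c = 0) : c = 0 := by
  have h2 : polyEval F (-Polynomial.X * p + Polynomial.C c) = 0 := by
    rw [map_add, map_mul, map_neg, polyEval_X, neg_neg, ← Polynomial.algebraMap_eq,
      AlgHom.commutes, h]
  have h3 := congrArg (Polynomial.eval 0) (polyEval_injective (h2.trans (map_zero _).symm))
  simpa using h3

/-- On the image of `O` the `y`-coordinate is a polynomial divisible by `t`, whereas for `σ x_23` it
is `1`. -/
theorem sigma_inj_two_three {s s' : Tet F} (hs : s ∈ extend (x F 2 3))
    (hs' : s' ∈ extend (x F 2 3)) (h : sigma F s = sigma F s') : s = s' := by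
  refine sigma_inj (fun p c hp => ?_) hs hs' h
  have h1 := congrArg (coord F 1) hp
  rw [sigma_x, genImage_eq, polyElt_apply, ofCoord, smul_elt, elt_add, coord_elt, map_zero] at h1
  refine eq_zero_of_polyEval (p := p.2.1 + p.2.2) ?_
  simp only [Matrix.cons_val, genCoord, Algebra.smul_def, mul_one] at h1
  rw [map_add, mul_add, h1]

/-- On the image of `O` the `x`-coordinate is a polynomial in `t`, whereas for `σ x_01` it is
`-t⁻¹`. -/
theorem sigma_inj_zero_one {s s' : Tet F} (hs : s ∈ extend (x F 0 1))
    (hs' : s' ∈ extend (x F 0 1)) (h : sigma F s = sigma F s') : s = s' := by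
  refine sigma_inj (fun p c hp => ?_) hs hs' h
  have h1 := congrArg (coord F 0) hp
  rw [sigma_x, genImage_eq, polyElt_apply, ofCoord, smul_elt, elt_add, coord_elt, map_zero] at h1
  refine eq_zero_of_polyEval (p := p.1) ?_
  simp only [Matrix.cons_val, genCoord, Algebra.smul_def] at h1
  linear_combination -t F * h1 - algebraMap F (LaurentAlg F) c * t_mul_tInv F

/-- Both sides lie in the extension of `O` by `x_01`, where `σ` is injective; in `L(sl₂)⁺` the image
of every `x_ij` satisfies `ad³ = 4 ad` on the whole algebra. -/
theorem adCube_zero_one (o : Onsager F) : AdCube F (x F 0 1) (ofOnsager F o) := by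
  have h1 := lie_x_zero_one_mem (ofOnsager_mem_extend (x F 0 1) o)
  refine sigma_inj_zero_one (lie_x_zero_one_mem (lie_x_zero_one_mem h1))
    (Submodule.smul_mem _ _ h1) ?_
  simp only [LieHom.map_lie, map_smul, sigma_x]
  exact lie_genImage_lie_lie 0 1 (by decide) _

theorem adCube_A (o : Onsager F) : AdCube F (x F 1 2) (ofOnsager F o) := by
  rw [AdCube, ← ofOnsager_A, ← LieHom.map_lie, ← LieHom.map_lie, ← LieHom.map_lie, ← map_smul]
  congr 1
  apply ofOnsager_injective
  simp only [LieHom.map_lie, map_smul, Loop.ofOnsager_A]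
  exact lie_genImage_lie_lie 1 2 (by decide) _

theorem adCube_B (o : Onsager F) : AdCube F (x F 0 3) (ofOnsager F o) := by
  rw [AdCube, ← ofOnsager_B, ← LieHom.map_lie, ← LieHom.map_lie, ← LieHom.map_lie, ← map_smul]
  congr 1
  apply ofOnsager_injective
  simp only [LieHom.map_lie, map_smul, Loop.ofOnsager_B]
  exact lie_genImage_lie_lie 0 3 (by decide) _

theorem isLike_onsagerBasis_A (i : ℕ) :
    IsLike 2 1 (by decide) (ofOnsager F (onsagerBasis F (Sum.inl i))) := by
  refine isLike_of (k := 0) (h := 3) _ (by decide) (by decide) ?_ (adCube_B _)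
  have : ⁅Onsager.A F, onsagerBasis F (Sum.inl i)⁆ = 0 := by
    apply ofOnsager_injective
    have h0 : Loop.ofOnsager F (Onsager.A F) = -A F 0 := by rw [A_zero, neg_neg]
    rw [LieHom.map_lie, ofOnsager_onsagerBasis, h0, neg_lie, family, lie_A_A, neg_zero, map_zero]
  rw [x_swap 1 2 (by decide), ← ofOnsager_A, neg_lie, ← LieHom.map_lie, this, map_zero, neg_zero]

theorem isLike_onsagerBasis_B (i : ℕ) :
    IsLike 0 3 (by decide) (ofOnsager F (onsagerBasis F (Sum.inr (Sum.inl i)))) := by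
  refine isLike_of (k := 1) (h := 2) _ (by decide) (by decide) ?_ (adCube_A _)
  have : ⁅Onsager.B F, onsagerBasis F (Sum.inr (Sum.inl i))⁆ = 0 := by
    apply ofOnsager_injective
    rw [LieHom.map_lie, ofOnsager_onsagerBasis, ← B_zero, family, lie_B_B, map_zero]
  rw [← ofOnsager_B, ← LieHom.map_lie, this, map_zero]

/-- The two conditions use different extensions of `O`: by `x_01` for the cubic relation, and by
`x_23` for commutation, where `σ x_23 = -ψ_0` commutes with `ψ_{i+1}`. -/
theorem isLike_onsagerBasis_psi (i : ℕ) :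
    IsLike 3 2 (by decide) (ofOnsager F (onsagerBasis F (Sum.inr (Sum.inr i)))) := by
  refine isLike_of (k := 0) (h := 1) _ (by decide) (by decide) ?_ (adCube_zero_one _)
  set o := onsagerBasis F (Sum.inr (Sum.inr i))
  rw [x_swap 2 3 (by decide), neg_lie, neg_eq_zero]
  refine sigma_inj_two_three (lie_x_two_three_mem (ofOnsager_mem_extend _ _))
    (Submodule.zero_mem _) ?_
  have h1 : sigma F (ofOnsager F o) = psi F (i + 1) := ofOnsager_onsagerBasis _
  have h2 : genImage F 2 3 = -psi F 0 := by simp [psi, genImage]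
  rw [LieHom.map_lie, sigma_x, h1, h2, neg_lie, lie_psi_psi, neg_zero, map_zero]

end Tet

end OnsagerLie

end

theorem mainTheorem5 (F : Type*) [Field F] [CharZero F] :
    -- `O` is (identified with) a subalgebra of `L(sl₂)⁺`
    Function.Injective (OnsagerLie.Loop.ofOnsager F) ∧
    -- the elements `A_i, B_i, ψ_{i+1}` form a basis of `O`, with `A_0 = -A` and `B_0 = B`, and
    -- they are `x_21`-like, `x_03`-like and `x_32`-like, respectively
    (∃ b : Module.Basis (ℕ ⊕ ℕ ⊕ ℕ) F (OnsagerLie.Onsager F),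
      (∀ s, OnsagerLie.Loop.ofOnsager F (b s) = OnsagerLie.Loop.family F s) ∧
      b (Sum.inl 0) = -OnsagerLie.Onsager.A F ∧
      b (Sum.inr (Sum.inl 0)) = OnsagerLie.Onsager.B F ∧
      (∀ i : ℕ, OnsagerLie.Tet.IsLike 2 1 (by decide)
        (OnsagerLie.Tet.ofOnsager F (b (Sum.inl i)))) ∧
      (∀ i : ℕ, OnsagerLie.Tet.IsLike 0 3 (by decide)
        (OnsagerLie.Tet.ofOnsager F (b (Sum.inr (Sum.inl i))))) ∧
      (∀ i : ℕ, OnsagerLie.Tet.IsLike 3 2 (by decide)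
        (OnsagerLie.Tet.ofOnsager F (b (Sum.inr (Sum.inr i)))))) ∧
    -- the Lie bracket
    (∀ i j : ℕ,
      ⁅OnsagerLie.Loop.A F i, OnsagerLie.Loop.A F j⁆ = 0 ∧
      ⁅OnsagerLie.Loop.B F i, OnsagerLie.Loop.B F j⁆ = 0 ∧
      ⁅OnsagerLie.Loop.psi F i, OnsagerLie.Loop.psi F j⁆ = 0 ∧
      ⁅OnsagerLie.Loop.psi F i, OnsagerLie.Loop.A F j⁆ =
        (2 : F) • OnsagerLie.Loop.psi F (i + j) + (2 : F) • OnsagerLie.Loop.A F (i + j) ∧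
      ⁅OnsagerLie.Loop.B F i, OnsagerLie.Loop.psi F j⁆ =
        (2 : F) • OnsagerLie.Loop.B F (i + j) + (2 : F) • OnsagerLie.Loop.psi F (i + j) ∧
      ⁅OnsagerLie.Loop.A F i, OnsagerLie.Loop.B F j⁆ =
        (2 : F) • OnsagerLie.Loop.A F (i + j) + (2 : F) • OnsagerLie.Loop.B F (i + j)
          - (4 : F) • OnsagerLie.Loop.psi F (i + j + 1)) := by

  refine ⟨OnsagerLie.Loop.ofOnsager_injective, ⟨OnsagerLie.Loop.onsagerBasis F,
    OnsagerLie.Loop.ofOnsager_onsagerBasis, ?_, ?_, OnsagerLie.Tet.isLike_onsagerBasis_A,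
    OnsagerLie.Tet.isLike_onsagerBasis_B, OnsagerLie.Tet.isLike_onsagerBasis_psi⟩,
    fun i j => ⟨OnsagerLie.Loop.lie_A_A i j, OnsagerLie.Loop.lie_B_B i j,
      OnsagerLie.Loop.lie_psi_psi i j, OnsagerLie.Loop.lie_psi_A i j,
      OnsagerLie.Loop.lie_B_psi i j, OnsagerLie.Loop.lie_A_B i j⟩⟩
  · apply OnsagerLie.Loop.ofOnsager_injective
    rw [OnsagerLie.Loop.ofOnsager_onsagerBasis, map_neg]
    exact OnsagerLie.Loop.A_zero
  · apply OnsagerLie.Loop.ofOnsager_injective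
    rw [OnsagerLie.Loop.ofOnsager_onsagerBasis]
    exact OnsagerLie.Loop.B_zero
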